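/- **Theorem (Recovery Algorithm).** Logarithms are to base $2$. A hypergraph $H$ on the vertex set $[n]$ is a set of subsets of $[n]$ (hyperedges). A hyperedge $e$ is *incident* on $W\subseteq[n]$ if $e\cap W\neq\emptyset$ and $e\setminus W\neq\emptyset$. An *$\ell_0$-sampler* with failure probability $\delta$, for integer vectors $x$ with entries of absolute value at most $U$ and at most $m$ nonzero entries, consists of a random seed $R$, a map $x\mapsto\mathcal S(x,R)$ that is additive in $x$, and an output rule applied to $R$ and $\mathcal S(x,R)$, which returns $\perp$ for $x=0$; for each such $x\ne 0$ it returns $\perp$ with probability at most $\delta$, and conditioned on not returning $\perp$ it returns a uniformly random element of the support of $x$. *Fingerprinting* $H$ at rate $p$ replaces each $e\in H$ by a random subset $\hat e\subseteq e$ that keeps every vertex of $e$ independently with probability $p$. The neighborhood of $v$ in the fingerprinted hypergraph is encoded by the vector $a_v\in\mathbb Z^{2^{[n]}}$ whose coordinate at $e\in H$ is $1$ if $v\in\hat e$ and $v\neq\max\hat e$, is $-(|\hat e|-1)$ if $v=\max\hat e$, and is $0$ if $v\notin\hat e$; the coordinates at $e\notin H$ are $0$. There are absolute constants $C$, $c>0$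 and $a\in\mathbb N$ such that for every $n\ge 1$ and every real $\phi\ge 1$ there are a number $q\le C\,\phi\,\log^{a}(n\phi)$ and rates $p_1,\dots,p_q\in[0,1]$ with the following property. Let $m\in\mathbb N$ and $\delta\le 1/2$, and let $\mathcal S$ be any $\ell_0$-sampler with failure probability $\delta$ for integer vectors with coordinates indexed by the subsets of $[n]$, entries of absolute value at most $n$, and at most $m$ nonzero entries. For a hypergraph $H$ on $[n]$ consider the linear sketch that stores $q$ $\ell_0$-samplers per vertex, namely, for each $t\le q$ and each vertex $v$, the sketch $\mathcal S(a_v^{(t)},R_t)$, where $a^{(t)}_v$ encodes the neighborhood of $v$ in $H$ fingerprinted at rate $p_t$. The fingerprints and the seeds $R_t$ are public randomness, independent of each other and over $t$, and are shared by all vertices. Then there is a recovery procedure, depending only on $n,\phi,m,\delta,\mathcal S$ and receiving only the public randomness, the sketch and a list of components, such that for every hypergraph $H$ on $[n]$ with at most $m$ hyperedges and all pairwise disjoint $V_1,\dots,V_k\subseteq[n]$, with probability at least $1-2^{-c\log^2 n}$ it returns a set $S\subseteq H$ and a label in $\{1,2\}$ for each $V_i$ such that: 1. if $V_i$ is labelled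 $1$, then $S$ contains all hyperedges of $H$ incident on $V_i$; 2. there is an assignment of hyperedges to components, each hyperedge being assigned to at most one component (its unique representative), on which it is incident, such that for every $V_i$ labelled $2$ at least $\phi\log n$ hyperedges of $S$ are assigned to $V_i$. -/

import Mathlib

open MeasureTheory

noncomputable section

namespace HypergraphSketch

/-- An `ℓ₀`-sampler given by a linear sketch, for integer vectors indexed by `ι` that have at most
`m` nonzero entries, each of absolute value at most `U`, with failure probability `δ`.
`sketch R x` is the (linear) sketch of `x` under the random seed `R`, and `output R y` is what is
returned when a sketch `y` is opened: `none` stands for `⊥`. The zero vector has no nonzero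
coordinate to return; a nonzero vector yields `⊥` with probability at most `δ`, and otherwise a
uniformly random element of its support. -/
structure L0Sampler (ι : Type*) [Fintype ι] (Seed : Type*) [MeasurableSpace Seed]
    (Sk : Type*) [AddCommGroup Sk] (U m : ℕ) (δ : ℝ) where
  /-- the distribution of the random seed -/
  law : Measure Seed
  isProbabilityMeasure_law : IsProbabilityMeasure law
  sketch : Seed → (ι → ℤ) →+ Sk
  output : Seed → Sk → Option ι
  measurableSet_output : ∀ (x : ι → ℤ) (i : ι),
    MeasurableSet {R | output R (sketch R x) = some i}
  output_zero : ∀ R, output R 0 = none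
  failure_le : ∀ x : ι → ℤ, x ≠ 0 → (∀ i, |x i| ≤ (U : ℤ)) →
    (Finset.univ.filter fun i => x i ≠ 0).card ≤ m →
    law.real {R | output R (sketch R x) = none} ≤ δ
  uniform : ∀ x : ι → ℤ, x ≠ 0 → (∀ i, |x i| ≤ (U : ℤ)) →
    (Finset.univ.filter fun i => x i ≠ 0).card ≤ m →
    ∀ i, law.real {R | output R (sketch R x) = some i} =
      law.real {R | output R (sketch R x) ≠ none} *
        ((if x i = 0 then 0 else 1) / ((Finset.univ.filter fun j => x j ≠ 0).card : ℝ))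

/-- A hyperedge on the vertex set `Fin n`; a hypergraph is a finite set of hyperedges. -/
abbrev Hyperedge (n : ℕ) : Type := Finset (Fin n)

/-- One coin per pair (hyperedge, vertex), deciding whether the vertex is kept. -/
abbrev Coins (n : ℕ) : Type := Hyperedge n → Fin n → Bool

/-- Independent coins, each `true` with probability `p`. -/
def coinLaw (n : ℕ) (p : unitInterval) : Measure (Coins n) :=
  Measure.pi fun _ => Measure.pi fun _ => ProbabilityTheory.bernoulliMeasure true false p

/-- The fingerprint of `e`: under `coinLaw n p`, each vertex of `e` is kept independently with
probability `p`. -/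
def fingerprint {n : ℕ} (F : Coins n) (e : Hyperedge n) : Hyperedge n :=
  e.filter fun v => F e v = true

/-- The entry of the vertex-hyperedge incidence matrix for the vertex `v` and the vertex set `e`:
`-(|e| - 1)` if `v` is the largest element of `e`, `1` for the other elements, `0` outside `e`. -/
def incidenceEntry {n : ℕ} (v : Fin n) (e : Hyperedge n) : ℤ :=
  if v ∈ e then (if ∀ w ∈ e, w ≤ v then -((e.card : ℤ) - 1) else 1) else 0

/-- The row of the vertex `v` in the incidence matrix of the fingerprinted hypergraph; the column
of a hyperedge `e` of `H` holds the encoding of the fingerprint of `e`. -/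
def neighborhoodVector {n : ℕ} (H : Finset (Hyperedge n)) (F : Coins n) (v : Fin n) :
    Hyperedge n → ℤ :=
  fun e => if e ∈ H then incidenceEntry v (fingerprint F e) else 0

/-- The public randomness of the sketch: for each of `q` layers, the fingerprinting coins and the
seed of the `ℓ₀`-samplers of that layer. The seed of a layer is shared by all vertices. -/
abbrev Randomness (n q : ℕ) (Seed : Type*) : Type _ := Fin q → Coins n × Seed

/-- The layers are independent, as are coins and seed within a layer; layer `t` is fingerprinted
at rate `p t`. -/
def randomnessLaw {n q : ℕ} (p : Fin q → unitInterval) {Seed : Type*} [MeasurableSpace Seed]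
    (μ : Measure Seed) : Measure (Randomness n q Seed) :=
  Measure.pi fun t => (coinLaw n (p t)).prod μ

/-- The fingerprinting sketch of `H`: for each layer, every vertex stores one `ℓ₀`-sampler of its
neighborhood in the hypergraph fingerprinted for that layer. -/
def fingerprintSketch {n q : ℕ} {Seed : Type*} [MeasurableSpace Seed] {Sk : Type*}
    [AddCommGroup Sk] {U m : ℕ} {δ : ℝ} (A : L0Sampler (Hyperedge n) Seed Sk U m δ)
    (H : Finset (Hyperedge n)) (ω : Randomness n q Seed) : Fin q → Fin n → Sk :=
  fun t v => A.sketch (ω t).2 (neighborhoodVector H (ω t).1 v)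

/-- The hyperedge `e` is incident on (touches) the component `W`: it has a vertex inside `W` and a
vertex outside `W`. -/
def Touches {n : ℕ} (e : Hyperedge n) (W : Finset (Fin n)) : Prop :=
  (e ∩ W).Nonempty ∧ (e \ W).Nonempty

/-- The set `S` and the indicator `complete` are a correct answer to the recovery problem for the
hypergraph `H`, the parameter `φ` and the components `V`. -/
structure IsRecovery {n k : ℕ} (H : Finset (Hyperedge n)) (φ : ℝ) (V : Fin k → Finset (Fin n))
    (S : Finset (Hyperedge n)) (complete : Fin k → Bool) : Prop where
  subset : S ⊆ H
  /-- Case 1: all hyperedges incident on the component have been returned. -/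
  all_incident : ∀ i, complete i = true → ∀ e ∈ H, Touches e (V i) → e ∈ S
  /-- Case 2: there is one assignment of hyperedges to incident components, each hyperedge to at
  most one, that gives all these components at least `φ log n` returned hyperedges. -/
  unique_representative : ∃ rep : Hyperedge n → Option (Fin k),
    (∀ e i, rep e = some i → Touches e (V i)) ∧
    ∀ i, complete i = false →
      φ * Real.logb 2 n ≤ ((S.filter fun e => rep e = some i).card : ℝ)

/-- A recovery procedure: from the public randomness, the sketch and a list of components it
computes a set of hyperedges and an indicator of the case for each component. It has no other
access to the hypergraph. -/
abbrev Decoder (n q : ℕ) (Seed Sk : Type*) : Type _ :=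
  Randomness n q Seed → (Fin q → Fin n → Sk) → (k : ℕ) → (Fin k → Finset (Fin n)) →
    Finset (Hyperedge n) × (Fin k → Bool)

end HypergraphSketch

end

/-! The recovery works in rounds of `T` layers. Round `j ≤ J` fingerprints at rate `2^(j-J)`, so the
rate starts at most `1/n` and doubles up to `1`. In each layer the sketches of the vertices of a
component are summed, and the sketches of the hyperedges already found are subtracted. By linearity
this is the sampler of a vector whose support is exactly the set of missing hyperedges whose
fingerprint touches the component (`sum_incidenceEntry_ne_zero_iff`,
`openSketch_fingerprintSketch`). Everything returned is added to the found set. One last round at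
rate `1` labels a component complete when all its samplers return `⊥`.

The invariant is that there is a set `B` of components not yet served such that the fingerprint of
every missing hyperedge hits at most 12 components of `B` in expectation. A round at rate `p` splits
`B` according to the expected number of touching hyperedges, with threshold `r = 140 K s`.

Components `D` above the threshold become served. In each layer such a component receives, with
probability at least `1/4`, a hyperedge touching at most 140 components of `B`
(`quarter_le_layerLaw_good`), so over the round it gets at least `r` good samples. A fixed hyperedge
is returned to `D` in a layer with probability at most `24/r`, hence in fewer than `s` layers. Each
hyperedge thus accounts for at most `140 s` good samples, and Hall's theorem gives each component of
`D` its own `K` representatives (`Served.of_card_le`).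

Components below the threshold have small supports, so a missing hyperedge whose fingerprint touches
one of them with probability at least `1/2` is returned in a layer with probability of order `1/r`,
and is found during the round. A hyperedge that is still missing touches `B \ D` with probability
below `1/2`; it then hits fewer than 6 of these components in expectation
(`half_le_edgeLaw_exists_touches`), and fewer than 12 at the doubled rate, which restores the
invariant. At rate `1` the fingerprint is the hyperedge itself, so no missing hyperedge touches an
unserved component.

Two points need care. The number of hyperedges may be exponential in `n`, so a union bound over all
of them is unaffordable: the repetition bound weights each hyperedge by its probability of being the
sample (`measureReal_mem_and_le_hitCount_le`), and only `O(n r)` hyperedges are likely to touch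
components of small degree (`card_likely_le`). Moreover the found set is random; since it depends on
earlier layers only, it can be fixed while the layers of the current round are integrated
(`pi_adaptive_le`). Within one layer the components share all randomness, and only union bounds are
used across them. -/

noncomputable section

namespace HypergraphSketch

/-! ### Product measures and tail bounds for counts of independent events -/

section Probability

/-- Resampling one coordinate preserves a product of probability measures. -/
theorem measurePreserving_update {ι : Type*} [Fintype ι] [DecidableEq ι] {X : ι → Type*}
    [∀ i, MeasurableSpace (X i)] (μ : ∀ i, Measure (X i)) [∀ i, IsProbabilityMeasure (μ i)]
    (i : ι) :
    MeasurePreserving (fun z : (∀ j, X j) × X i => Function.update z.1 i z.2)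
      ((Measure.pi μ).prod (μ i)) (Measure.pi μ) := by
  have hm : Measurable (fun z : (∀ j, X j) × X i => Function.update z.1 i z.2) := by
    refine measurable_pi_iff.2 fun j => ?_
    by_cases h : j = i
    · subst h; simpa using measurable_snd
    · simp only [Function.update_of_ne h]; fun_prop
  refine ⟨hm, (Measure.pi_eq fun s hs => ?_).symm⟩
  rw [Measure.map_apply hm (MeasurableSet.univ_pi hs)]
  have : (fun z : (∀ j, X j) × X i => Function.update z.1 i z.2) ⁻¹' (Set.univ.pi s) =
      (Set.univ.pi (Function.update s i Set.univ)) ×ˢ s i := by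
    ext ⟨x, y⟩
    simp only [Set.mem_preimage, Set.mem_pi, Set.mem_univ, true_implies, Set.mem_prod]
    constructor
    · intro h
      refine ⟨fun j => ?_, by simpa using h i⟩
      by_cases hj : j = i
      · subst hj; simp
      · simpa [hj] using h j
    · rintro ⟨h1, h2⟩ j
      by_cases hj : j = i
      · subst hj; simpa using h2
      · simpa [hj] using h1 j
  rw [this, Measure.prod_prod, Measure.pi_pi, ← Finset.mul_prod_erase _ _ (Finset.mem_univ i),
    ← Finset.mul_prod_erase _ (fun j => μ j (s j)) (Finset.mem_univ i)]
  simp only [Function.update_self, measure_univ, one_mul]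
  rw [mul_comm]
  congr 1
  refine Finset.prod_congr rfl fun j hj => ?_
  rw [Function.update_of_ne (Finset.ne_of_mem_erase hj)]

theorem integral_pi_update {ι : Type*} [Fintype ι] [DecidableEq ι] {X : ι → Type*}
    [∀ i, Finite (X i)] [∀ i, MeasurableSpace (X i)] [∀ i, MeasurableSingletonClass (X i)]
    (μ : ∀ i, Measure (X i)) [∀ i, IsProbabilityMeasure (μ i)] (i : ι) (G : (∀ j, X j) → ℝ) :
    ∫ x, G x ∂Measure.pi μ = ∫ x, ∫ y, G (Function.update x i y) ∂μ i ∂Measure.pi μ := by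
  rw [← (measurePreserving_update μ i).map_eq,
    integral_map (measurePreserving_update μ i).measurable.aemeasurable
      (StronglyMeasurable.of_discrete).aestronglyMeasurable,
    integral_prod _ Integrable.of_finite, (measurePreserving_update μ i).map_eq]

/-- A function of one coordinate is independent of a function of the others. -/
theorem integral_pi_mul_of_update_eq {ι : Type*} [Fintype ι] [DecidableEq ι] {X : ι → Type*}
    [∀ i, Finite (X i)] [∀ i, MeasurableSpace (X i)] [∀ i, MeasurableSingletonClass (X i)]
    (μ : ∀ i, Measure (X i)) [∀ i, IsProbabilityMeasure (μ i)] (i : ι) (g : X i → ℝ)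
    (h : (∀ j, X j) → ℝ) (hh : ∀ x y, h (Function.update x i y) = h x) :
    ∫ x, g (x i) * h x ∂Measure.pi μ = (∫ y, g y ∂μ i) * ∫ x, h x ∂Measure.pi μ := by
  rw [integral_pi_update μ i]
  simp_rw [Function.update_self, hh, integral_mul_const]
  rw [integral_const_mul]

open Classical in
/-- The number of coordinates that lie in `E`. -/
def hitCount {τ Ω : Type*} [Fintype τ] (E : Set Ω) (ω : τ → Ω) : ℕ :=
  (Finset.univ.filter fun t => ω t ∈ E).card

theorem card_le_hitCount {τ Ω : Type*} [Fintype τ] {E : Set Ω} {ω : τ → Ω} {s : Finset τ}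
    (h : ∀ t ∈ s, ω t ∈ E) : s.card ≤ hitCount E ω := by
  classical
  exact Finset.card_le_card fun t ht => Finset.mem_filter.2 ⟨Finset.mem_univ t, h t ht⟩

theorem hitCount_lt_one_iff {τ Ω : Type*} [Fintype τ] {E : Set Ω} {ω : τ → Ω} :
    hitCount E ω < 1 ↔ ∀ t, ω t ∉ E := by
  simp [hitCount, Finset.filter_eq_empty_iff]

theorem measureReal_biUnion_le_mul {ι Ω : Type*} [MeasurableSpace Ω] (μ : Measure Ω)
    (D : Finset ι) (f : ι → Set Ω) {a c : ℝ} (ha : 0 ≤ a) (hD : (D.card : ℝ) ≤ c)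
    (h : ∀ i ∈ D, μ.real (f i) ≤ a) : μ.real (⋃ i ∈ D, f i) ≤ c * a := by
  refine (measureReal_biUnion_finset_le D f).trans ((Finset.sum_le_card_nsmul _ _ a h).trans ?_)
  rw [nsmul_eq_mul]
  exact mul_le_mul_of_nonneg_right hD ha

theorem measurable_hitCount {τ Ω : Type*} [Fintype τ] [MeasurableSpace Ω] {E : Set Ω}
    (hE : MeasurableSet E) :
    Measurable fun ω : τ → Ω => hitCount E ω := by
  classical
  simp_rw [hitCount, Finset.card_filter]
  refine Finset.measurable_sum _ fun t _ => ?_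
  exact Measurable.ite (measurable_pi_apply t hE) measurable_const measurable_const

theorem measurableSet_hitCount {τ Ω : Type*} [Fintype τ] [MeasurableSpace Ω] {E : Set Ω}
    (hE : MeasurableSet E) (P : ℕ → Prop) :
    MeasurableSet {ω : τ → Ω | P (hitCount E ω)} :=
  measurable_hitCount hE (MeasurableSet.of_discrete (s := {k | P k}))

theorem integral_one_add_indicator {Ω : Type*} [MeasurableSpace Ω] (ν : Measure Ω)
    [IsProbabilityMeasure ν] {E : Set Ω} (hE : MeasurableSet E) (a b : ℝ) :
    ∫ x, (a + b * E.indicator 1 x) ∂ν = a + b * ν.real E := by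
  have h1 : Integrable (E.indicator (1 : Ω → ℝ)) ν :=
    (integrable_indicator_iff hE).2 (integrable_const (1 : ℝ)).integrableOn
  rw [integral_add (integrable_const _) (h1.const_mul _), integral_const_mul,
    integral_indicator_one hE]
  simp

/-- Lower tail of the number of independent events that occur. -/
theorem measureReal_hitCount_lt_le {τ Ω : Type*} [Fintype τ] [MeasurableSpace Ω] (ν : Measure Ω)
    [IsProbabilityMeasure ν] {E : Set Ω} (hE : MeasurableSet E) (r : ℕ) :
    (Measure.pi fun _ : τ => ν).real {ω | hitCount E ω < r} ≤
      2 ^ r * (1 - ν.real E / 2) ^ Fintype.card τ := by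
  have hms := measurableSet_hitCount (τ := τ) hE (fun k => k < r)
  -- Markov's inequality for `2^(-N)`, where `N` is the count; its expectation factors over the
  -- coordinates.
  have hprod : ∀ ω : τ → Ω, ∏ t, (1 + (-1 / 2) * E.indicator (1 : Ω → ℝ) (ω t)) =
      (1 / 2) ^ hitCount E ω := by
    intro ω
    classical
    rw [hitCount, ← Finset.prod_const, Finset.prod_filter]
    refine Finset.prod_congr rfl fun t _ => ?_
    by_cases h : ω t ∈ E <;> simp [h]; norm_num
  have key : (1 - ν.real E / 2) ^ Fintype.card τ =
      ∫ ω : τ → Ω, (1 / 2 : ℝ) ^ hitCount E ω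
        ∂(Measure.pi fun _ : τ => ν) := by
    simp_rw [← hprod]
    rw [integral_fintype_prod_eq_pow (fun x => 1 + (-1 / 2) * E.indicator (1 : Ω → ℝ) x),
      integral_one_add_indicator ν hE]
    ring
  rw [key, ← integral_const_mul, ← integral_indicator_one hms]
  have hmeas := measurable_hitCount (τ := τ) hE
  refine integral_mono_of_nonneg (Filter.Eventually.of_forall fun ω =>
    Set.indicator_nonneg (fun _ _ => zero_le_one) _) ?_ (Filter.Eventually.of_forall fun ω => ?_)
  · refine Integrable.const_mul (Integrable.of_bound (C := 1) ?_ ?_) _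
    · exact ((measurable_of_countable fun k : ℕ => (1 / 2 : ℝ) ^ k).comp
        hmeas).aestronglyMeasurable
    · refine Filter.Eventually.of_forall fun ω => ?_
      rw [norm_pow]
      exact pow_le_one₀ (norm_nonneg _) (by norm_num)
  · by_cases h : ω ∈ {ω : τ → Ω | hitCount E ω < r}
    · simp only [Set.indicator_of_mem h, Pi.one_apply]
      have h' : hitCount E ω ≤ r := le_of_lt h
      have h2 : (1 / 2 : ℝ) ^ r ≤ (1 / 2) ^ hitCount E ω :=
        pow_le_pow_of_le_one (by norm_num) (by norm_num) h'
      calc (1 : ℝ) = 2 ^ r * (1 / 2) ^ r := by rw [← mul_pow]; norm_num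
        _ ≤ _ := mul_le_mul_of_nonneg_left h2 (by positivity)
    · simp only [Set.indicator_of_notMem h]; positivity

/-- Bound on the probability that an event happens in a given coordinate while a weaker event
happens in many coordinates. -/
theorem measureReal_mem_and_le_hitCount_le {τ Ω : Type*} [Fintype τ] [MeasurableSpace Ω]
    (ν : Measure Ω) [IsProbabilityMeasure ν] {X E : Set Ω} (hX : MeasurableSet X)
    (hE : MeasurableSet E) (hXE : X ⊆ E) (t : τ) (s : ℕ) :
    (Measure.pi fun _ : τ => ν).real
        {ω | ω t ∈ X ∧ s ≤ hitCount E ω} ≤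
      (1 / 2) ^ s * (2 * ν.real X * (1 + ν.real E) ^ Fintype.card τ) := by
  have hms : MeasurableSet {ω : τ → Ω | ω t ∈ X ∧ s ≤ hitCount E ω} :=
    (measurable_pi_apply t hX).inter (measurableSet_hitCount (τ := τ) hE (fun k => s ≤ k))
  classical
  -- Exponential moment `2^N` restricted to the event at `t`. As `X ⊆ E`, coordinate `t` contributes
  -- exactly the factor `2` there, so a factor `ν X` survives; this is what allows summing over
  -- disjoint events `X` later.
  set g : τ → Ω → ℝ := fun u x =>
    if u = t then 0 + 2 * X.indicator (1 : Ω → ℝ) x else 1 + 1 * E.indicator (1 : Ω → ℝ) x with hg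
  have hprod : ∀ ω : τ → Ω, ω t ∈ X →
      ∏ u, g u (ω u) = 2 ^ hitCount E ω := by
    intro ω hω
    classical
    rw [hitCount, ← Finset.prod_const, Finset.prod_filter]
    refine Finset.prod_congr rfl fun u _ => ?_
    by_cases hu : u = t
    · subst hu; simp [hg, hω, hXE hω]
    · by_cases h : ω u ∈ E <;> simp [hg, hu, h]; norm_num
  have hgint : ∀ u, ∫ x, g u x ∂ν = if u = t then 2 * ν.real X else 1 + ν.real E := by
    intro u
    by_cases hu : u = t
    · simp only [hg, hu, if_true]; rw [integral_one_add_indicator ν hX]; ring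
    · simp only [hg, hu, if_false]; rw [integral_one_add_indicator ν hE]; ring
  have hgnn : ∀ u x, 0 ≤ g u x := by
    intro u x
    have h1 : 0 ≤ X.indicator (1 : Ω → ℝ) x := Set.indicator_nonneg (fun _ _ => zero_le_one) _
    have h2 : 0 ≤ E.indicator (1 : Ω → ℝ) x := Set.indicator_nonneg (fun _ _ => zero_le_one) _
    by_cases hu : u = t
    · simp only [hg, hu, if_true]; positivity
    · simp only [hg, hu, if_false]; positivity
  have hgi : ∀ u, Integrable (g u) ν := by
    intro u
    have h1 : Integrable (X.indicator (1 : Ω → ℝ)) ν :=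
      (integrable_indicator_iff hX).2 (integrable_const (1 : ℝ)).integrableOn
    have h2 : Integrable (E.indicator (1 : Ω → ℝ)) ν :=
      (integrable_indicator_iff hE).2 (integrable_const (1 : ℝ)).integrableOn
    by_cases hu : u = t
    · simp only [hg, hu, if_true]; exact (integrable_const _).add (h1.const_mul _)
    · simp only [hg, hu, if_false]; exact (integrable_const _).add (h2.const_mul _)
  have key : ∫ ω : τ → Ω, ∏ u, g u (ω u) ∂(Measure.pi fun _ : τ => ν) ≤
      2 * ν.real X * (1 + ν.real E) ^ Fintype.card τ := by
    rw [integral_fintype_prod_eq_prod]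
    simp_rw [hgint]
    rw [← Finset.mul_prod_erase _ _ (Finset.mem_univ t), if_pos rfl]
    refine mul_le_mul_of_nonneg_left ?_ (by positivity)
    rw [Finset.prod_congr rfl (g := fun _ => 1 + ν.real E)
      (fun u hu => if_neg (Finset.ne_of_mem_erase hu)), Finset.prod_const]
    exact pow_le_pow_right₀ (by linarith [measureReal_nonneg (μ := ν) (s := E)])
      (Finset.card_le_univ _)
  rw [← integral_indicator_one hms]
  refine le_trans ?_ (mul_le_mul_of_nonneg_left key (by positivity))
  rw [← integral_const_mul]
  refine integral_mono_of_nonneg (Filter.Eventually.of_forall fun ω =>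
    Set.indicator_nonneg (fun _ _ => zero_le_one) _)
    ((Integrable.fintype_prod (f := g) hgi).const_mul _) (Filter.Eventually.of_forall fun ω => ?_)
  by_cases h : ω ∈ {ω : τ → Ω | ω t ∈ X ∧ s ≤ hitCount E ω}
  · simp only [Set.indicator_of_mem h, Pi.one_apply]
    rw [hprod ω h.1]
    calc (1 : ℝ) = (1 / 2) ^ s * 2 ^ s := by rw [← mul_pow]; norm_num
      _ ≤ _ := by
        gcongr
        · norm_num
        · exact h.2
  · simp only [Set.indicator_of_notMem h]
    exact mul_nonneg (by positivity) (Finset.prod_nonneg fun u _ => hgnn u _)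

end Probability

/-! ### The fingerprint of a single hyperedge -/

section EdgeLaw

/-- The law of the coins of a single hyperedge. -/
def edgeLaw (n : ℕ) (p : unitInterval) : Measure (Fin n → Bool) :=
  Measure.pi fun _ => ProbabilityTheory.bernoulliMeasure true false p

instance (n : ℕ) (p : unitInterval) : IsProbabilityMeasure (edgeLaw n p) := by
  unfold edgeLaw; infer_instance

theorem coinLaw_eq (n : ℕ) (p : unitInterval) :
    coinLaw n p = Measure.pi fun _ => edgeLaw n p := rfl

instance (n : ℕ) (p : unitInterval) : IsProbabilityMeasure (coinLaw n p) := by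
  rw [coinLaw_eq]; infer_instance

/-- The part of `e` kept by the coins `ζ`. -/
def keptPart {n : ℕ} (ζ : Fin n → Bool) (e : Hyperedge n) : Hyperedge n :=
  e.filter fun v => ζ v = true

theorem fingerprint_eq {n : ℕ} (F : Coins n) (e : Hyperedge n) :
    fingerprint F e = keptPart (F e) e := rfl

/-- The probability that at least one of `u` vertices is kept at rate `p`. -/
def hitProb (p : ℝ) (u : ℕ) : ℝ := 1 - (1 - p) ^ u

theorem hitProb_nonneg (p : unitInterval) (u : ℕ) : 0 ≤ hitProb p u :=
  sub_nonneg.2 (pow_le_one₀ (by linarith [p.2.2]) (by linarith [p.2.1]))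

theorem hitProb_le_one (p : unitInterval) (u : ℕ) : hitProb p u ≤ 1 :=
  sub_le_self _ (pow_nonneg (by linarith [p.2.2]) _)

theorem hitProb_zero (p : ℝ) : hitProb p 0 = 0 := by simp [hitProb]

theorem hitProb_one {u : ℕ} (hu : u ≠ 0) : hitProb 1 u = 1 := by simp [hitProb, hu]

theorem hitProb_le_mul (p : unitInterval) (u : ℕ) : hitProb p u ≤ u * p := by
  have := one_add_mul_le_pow (a := -(p : ℝ)) (by linarith [p.2.2]) u
  unfold hitProb
  rw [sub_eq_add_neg 1 (p : ℝ)]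
  linarith

/-- Controls the loss in the invariant when the rate is doubled between rounds. -/
theorem hitProb_two_mul_le {p : ℝ} (h0 : 0 ≤ p) (h1 : 2 * p ≤ 1) (u : ℕ) :
    hitProb (2 * p) u ≤ 2 * hitProb p u := by
  induction u with
  | zero => simp [hitProb]
  | succ u ih =>
    have : (1 - 2 * p) ^ u ≤ (1 - p) ^ u := pow_le_pow_left₀ (by linarith) (by linarith) u
    have h2 := mul_le_mul_of_nonneg_left this (show 0 ≤ 2 * p by linarith)
    unfold hitProb at *
    rw [pow_succ, pow_succ]
    nlinarith

theorem prod_one_sub_le_inv {ι : Type*} (s : Finset ι) (h : ι → ℝ) (h0 : ∀ i ∈ s, 0 ≤ h i)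
    (h1 : ∀ i ∈ s, h i ≤ 1) : ∏ i ∈ s, (1 - h i) ≤ 1 / (1 + ∑ i ∈ s, h i) := by
  classical
  induction s using Finset.induction_on with
  | empty => simp
  | insert a s ha ih =>
    have h0' := h0 a (Finset.mem_insert_self a s)
    have h1' := h1 a (Finset.mem_insert_self a s)
    have hs : 0 ≤ ∑ i ∈ s, h i :=
      Finset.sum_nonneg fun i hi => h0 i (Finset.mem_insert_of_mem hi)
    have ih' := ih (fun i hi => h0 i (Finset.mem_insert_of_mem hi))
      (fun i hi => h1 i (Finset.mem_insert_of_mem hi))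
    rw [Finset.prod_insert ha, Finset.sum_insert ha]
    refine (mul_le_mul_of_nonneg_left ih' (by linarith)).trans ?_
    rw [mul_one_div, div_le_div_iff₀ (by linarith) (by linarith)]
    nlinarith [mul_nonneg h0' hs, mul_nonneg (mul_nonneg h0' h0') hs, mul_nonneg h0' h0']

theorem prod_one_sub_le_exp {ι : Type*} (s : Finset ι) (h : ι → ℝ)
    (h1 : ∀ i ∈ s, h i ≤ 1) : ∏ i ∈ s, (1 - h i) ≤ Real.exp (-∑ i ∈ s, h i) := by
  rw [← Finset.sum_neg_distrib, Real.exp_sum]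
  refine Finset.prod_le_prod (fun i hi => by linarith [h1 i hi]) fun i _ => ?_
  have := Real.add_one_le_exp (-h i)
  linarith

variable {n : ℕ}

theorem edgeLaw_miss (p : unitInterval) (U : Finset (Fin n)) :
    (edgeLaw n p).real {ζ | ∀ v ∈ U, ζ v = false} = (1 - (p : ℝ)) ^ U.card := by
  classical
  have : {ζ : Fin n → Bool | ∀ v ∈ U, ζ v = false} =
      Set.univ.pi fun v => if v ∈ U then {false} else Set.univ := by
    ext ζ
    simp only [Set.mem_ofPred_eq, Set.mem_pi, Set.mem_univ, true_implies]
    refine forall_congr' fun v => ?_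
    by_cases h : v ∈ U <;> simp [h]
  rw [this, edgeLaw, measureReal_def, Measure.pi_pi, ENNReal.toReal_prod, ← Finset.prod_const,
    ← Finset.prod_subset (Finset.subset_univ U)]
  · refine Finset.prod_congr rfl fun v hv => ?_
    rw [if_pos hv, ← measureReal_def, ProbabilityTheory.bernoulliMeasure_real_apply_of_notMem_of_mem]
    all_goals simp
  · intro v _ hv
    simp [hv]

theorem edgeLaw_hit (p : unitInterval) (U : Finset (Fin n)) :
    (edgeLaw n p).real {ζ | ∃ v ∈ U, ζ v = true} = hitProb p U.card := by
  have : {ζ : Fin n → Bool | ∃ v ∈ U, ζ v = true} = {ζ | ∀ v ∈ U, ζ v = false}ᶜ := by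
    ext ζ; simp
  rw [this, probReal_compl_eq_one_sub (.of_discrete), edgeLaw_miss, hitProb]

theorem edgeLaw_hit_miss (p : unitInterval) {U W : Finset (Fin n)} (h : Disjoint U W) :
    (edgeLaw n p).real {ζ | (∃ v ∈ U, ζ v = true) ∧ ∀ v ∈ W, ζ v = false} =
      hitProb p U.card * (1 - (p : ℝ)) ^ W.card := by
  have h1 : {ζ : Fin n → Bool | (∃ v ∈ U, ζ v = true) ∧ ∀ v ∈ W, ζ v = false} =
      {ζ | ∀ v ∈ W, ζ v = false} \ {ζ | ∀ v ∈ U ∪ W, ζ v = false} := by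
    ext ζ
    simp only [Set.mem_ofPred_eq, Set.mem_sdiff, Finset.mem_union, not_forall]
    constructor
    · rintro ⟨⟨v, hv, h1⟩, h2⟩
      exact ⟨h2, v, Or.inl hv, by simp [h1]⟩
    · rintro ⟨h2, v, hv | hv, h1⟩
      · exact ⟨⟨v, hv, by simpa using h1⟩, h2⟩
      · exact absurd (h2 v hv) h1
  have h2 : {ζ : Fin n → Bool | ∀ v ∈ U ∪ W, ζ v = false} ⊆ {ζ | ∀ v ∈ W, ζ v = false} :=
    fun ζ hζ v hv => hζ v (Finset.mem_union_right _ hv)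
  rw [h1, measureReal_sdiff h2 (.of_discrete), edgeLaw_miss, edgeLaw_miss, Finset.card_union_of_disjoint h, pow_add, hitProb]
  ring

theorem edgeLaw_hit_hit (p : unitInterval) {U W : Finset (Fin n)} (h : Disjoint U W) :
    (edgeLaw n p).real {ζ | (∃ v ∈ U, ζ v = true) ∧ ∃ v ∈ W, ζ v = true} =
      hitProb p U.card * hitProb p W.card := by
  have h1 : {ζ : Fin n → Bool | (∃ v ∈ U, ζ v = true) ∧ ∃ v ∈ W, ζ v = true} =
      {ζ | ∃ v ∈ U, ζ v = true} \ {ζ | (∃ v ∈ U, ζ v = true) ∧ ∀ v ∈ W, ζ v = false} := by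
    ext ζ
    simp only [Set.mem_ofPred_eq, Set.mem_sdiff]
    constructor
    · rintro ⟨h1, v, hv, h2⟩
      exact ⟨h1, fun h3 => by simpa [h2] using h3.2 v hv⟩
    · rintro ⟨h1, h2⟩
      refine ⟨h1, ?_⟩
      by_contra h3
      push Not at h3
      exact h2 ⟨h1, fun v hv => by simpa using h3 v hv⟩
  rw [h1, measureReal_sdiff (fun ζ hζ => hζ.1) (.of_discrete),
    edgeLaw_hit, edgeLaw_hit_miss p h, hitProb, hitProb]
  ring

theorem touches_keptPart_iff {ζ : Fin n → Bool} {e : Hyperedge n} {W : Finset (Fin n)} :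
    Touches (keptPart ζ e) W ↔
      (∃ v ∈ e ∩ W, ζ v = true) ∧ ∃ v ∈ e \ W, ζ v = true := by
  simp only [Touches, keptPart, Finset.Nonempty, Finset.mem_inter, Finset.mem_filter,
    Finset.mem_sdiff]
  constructor
  · rintro ⟨⟨v, ⟨h1, h2⟩, h3⟩, w, ⟨h4, h5⟩, h6⟩
    exact ⟨⟨v, ⟨h1, h3⟩, h2⟩, w, ⟨h4, h6⟩, h5⟩
  · rintro ⟨⟨v, ⟨h1, h2⟩, h3⟩, w, ⟨h4, h5⟩, h6⟩
    exact ⟨⟨v, ⟨h1, h3⟩, h2⟩, w, ⟨h4, h6⟩, h5⟩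

/-- The probability that the fingerprint of `e` at rate `p` touches `W`. -/
def touchProb (p : ℝ) (e : Hyperedge n) (W : Finset (Fin n)) : ℝ :=
  hitProb p (e ∩ W).card * hitProb p (e \ W).card

theorem edgeLaw_touches (p : unitInterval) (e : Hyperedge n) (W : Finset (Fin n)) :
    (edgeLaw n p).real {ζ | Touches (keptPart ζ e) W} = touchProb p e W := by
  simp_rw [touches_keptPart_iff]
  refine edgeLaw_hit_hit p ?_
  exact Finset.disjoint_left.2 fun v h1 h2 =>
    (Finset.mem_sdiff.1 h2).2 (Finset.mem_inter.1 h1).2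

theorem touchProb_nonneg (p : unitInterval) (e : Hyperedge n) (W : Finset (Fin n)) :
    0 ≤ touchProb p e W := mul_nonneg (hitProb_nonneg _ _) (hitProb_nonneg _ _)

theorem touchProb_le_hitProb (p : unitInterval) (e : Hyperedge n) (W : Finset (Fin n)) :
    touchProb p e W ≤ hitProb p (e ∩ W).card :=
  mul_le_of_le_one_right (hitProb_nonneg _ _) (hitProb_le_one _ _)

variable {k : ℕ} {V : Fin k → Finset (Fin n)}

theorem pairwiseDisjoint_inter (hV : Pairwise (Function.onFun Disjoint V)) (e : Hyperedge n)
    (A : Finset (Fin k)) : (A : Set (Fin k)).PairwiseDisjoint fun j => e ∩ V j :=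
  fun _ _ _ _ hij => (hV hij).mono Finset.inter_subset_right Finset.inter_subset_right

theorem pow_card_biUnion (hV : Pairwise (Function.onFun Disjoint V)) (e : Hyperedge n)
    (A : Finset (Fin k)) (p : ℝ) :
    (1 - p) ^ (A.biUnion fun j => e ∩ V j).card =
      ∏ j ∈ A, (1 - hitProb p (e ∩ V j).card) := by
  rw [Finset.card_biUnion (fun i hi j hj hij => pairwiseDisjoint_inter hV e A hi hj hij),
    ← Finset.prod_pow_eq_pow_sum]
  simp [hitProb]

/-- The expected number of other components of `A` that are touched, given that `V i` is. -/
theorem sum_edgeLaw_touches_touches_le (hV : Pairwise (Function.onFun Disjoint V))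
    (p : unitInterval) (e : Hyperedge n) (A : Finset (Fin k)) {i : Fin k} (hi : i ∈ A) :
    ∑ j ∈ A, (edgeLaw n p).real
        {ζ | Touches (keptPart ζ e) (V i) ∧ Touches (keptPart ζ e) (V j)} ≤
      (2 + ∑ j ∈ A, hitProb p (e ∩ V j).card) * touchProb p e (V i) := by
  set μ := ∑ j ∈ A.erase i, hitProb p (e ∩ V j).card with hμ
  have hμ0 : 0 ≤ μ := Finset.sum_nonneg fun j _ => hitProb_nonneg _ _
  have hμle : μ ≤ ∑ j ∈ A, hitProb p (e ∩ V j).card :=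
    Finset.sum_le_sum_of_subset_of_nonneg (Finset.erase_subset _ _) fun j _ _ => hitProb_nonneg _ _
  -- The other components of `A` lie outside `V i`, so hitting any of them hits `e \ V i`; the
  -- product of their miss probabilities is at most `1 / (1 + μ)`.
  have hout : μ / (1 + μ) ≤ hitProb p (e \ V i).card := by
    have h1 : (1 - (p : ℝ)) ^ (e \ V i).card ≤
        (1 - (p : ℝ)) ^ ((A.erase i).biUnion fun j => e ∩ V j).card := by
      refine pow_le_pow_of_le_one (by linarith [p.2.2]) (by linarith [p.2.1])
        (Finset.card_le_card fun v hv => ?_)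
      simp only [Finset.mem_biUnion, Finset.mem_erase, Finset.mem_inter] at hv
      obtain ⟨j, ⟨hji, -⟩, hve, hvj⟩ := hv
      exact Finset.mem_sdiff.2 ⟨hve, Finset.disjoint_left.1 (hV hji) hvj⟩
    rw [pow_card_biUnion hV] at h1
    have h2 := prod_one_sub_le_inv (A.erase i) (fun j => hitProb p (e ∩ V j).card)
      (fun j _ => hitProb_nonneg _ _) (fun j _ => hitProb_le_one _ _)
    have h3 : μ / (1 + μ) = 1 - 1 / (1 + μ) := by field_simp; ring
    rw [h3, hitProb]
    linarith
  -- Hence, conditioned on touching `V i` rather than merely hitting it, the expected number of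
  -- other components hit grows from `μ` to at most `1 + μ`.
  have hmul : hitProb p (e ∩ V i).card * μ ≤ (1 + μ) * touchProb p e (V i) := by
    have := mul_le_mul_of_nonneg_left hout (hitProb_nonneg p (e ∩ V i).card)
    rw [div_eq_mul_inv, ← mul_assoc, ← div_eq_mul_inv, div_le_iff₀ (by linarith)] at this
    unfold touchProb
    linarith
  rw [← Finset.add_sum_erase _ _ hi]
  have hfirst : (edgeLaw n p).real
      {ζ | Touches (keptPart ζ e) (V i) ∧ Touches (keptPart ζ e) (V i)} = touchProb p e (V i) := by
    simp only [and_self]; exact edgeLaw_touches p e (V i)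
  have hrest : ∑ j ∈ A.erase i, (edgeLaw n p).real
      {ζ | Touches (keptPart ζ e) (V i) ∧ Touches (keptPart ζ e) (V j)} ≤
        hitProb p (e ∩ V i).card * μ := by
    rw [hμ, Finset.mul_sum]
    refine Finset.sum_le_sum fun j hj => ?_
    rw [← edgeLaw_hit_hit p ((hV (Finset.ne_of_mem_erase hj).symm).mono
      Finset.inter_subset_right Finset.inter_subset_right)]
    refine measureReal_mono fun ζ hζ => ?_
    exact ⟨(touches_keptPart_iff.1 hζ.1).1, (touches_keptPart_iff.1 hζ.2).1⟩
  rw [hfirst]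
  have := touchProb_nonneg p e (V i)
  nlinarith [mul_le_mul_of_nonneg_right hμle this]

instance (e : Hyperedge n) (W : Finset (Fin n)) : Decidable (Touches e W) := Classical.dec _

/-- The number of components in `A` touched by the fingerprint `e`. -/
def touchCount (V : Fin k → Finset (Fin n)) (A : Finset (Fin k)) (e : Hyperedge n) : ℕ :=
  (A.filter fun j => Touches e (V j)).card

/-- Markov's inequality for the number of touched components, conditioned on touching `V i`; the
conditional mean is bounded by `sum_edgeLaw_touches_touches_le`. -/
theorem edgeLaw_touches_crowded_le (hV : Pairwise (Function.onFun Disjoint V))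
    (p : unitInterval) (e : Hyperedge n) (A : Finset (Fin k)) {i : Fin k} (hi : i ∈ A) (M : ℕ) :
    M * (edgeLaw n p).real
        {ζ | Touches (keptPart ζ e) (V i) ∧ M < touchCount V A (keptPart ζ e)} ≤
      (2 + ∑ j ∈ A, hitProb p (e ∩ V j).card) * touchProb p e (V i) := by
  classical
  refine le_trans ?_ (sum_edgeLaw_touches_touches_le hV p e A hi)
  simp_rw [← integral_indicator_one (MeasurableSet.of_discrete (α := Fin n → Bool))]
  rw [← integral_const_mul, ← integral_finsetSum _ fun j _ => Integrable.of_finite]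
  refine integral_mono Integrable.of_finite Integrable.of_finite fun ζ => ?_
  by_cases h : ζ ∈ {ζ : Fin n → Bool |
      Touches (keptPart ζ e) (V i) ∧ M < touchCount V A (keptPart ζ e)}
  · simp only [Set.indicator_of_mem h, Pi.one_apply, mul_one]
    have h2 : ∀ j ∈ A, ({ζ : Fin n → Bool | Touches (keptPart ζ e) (V i) ∧
        Touches (keptPart ζ e) (V j)}.indicator (1 : (Fin n → Bool) → ℝ) ζ) =
          if Touches (keptPart ζ e) (V j) then 1 else 0 := by
      intro j _
      by_cases hj : Touches (keptPart ζ e) (V j) <;> simp [hj, h.1]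
    rw [Finset.sum_congr rfl h2, Finset.sum_boole]
    exact_mod_cast h.2.le
  · simp only [Set.indicator_of_notMem h, mul_zero]
    exact Finset.sum_nonneg fun j _ => Set.indicator_nonneg (fun _ _ => zero_le_one) _

/-- A hyperedge whose fingerprint is expected to hit many components touches one of them with
probability at least `1 / 2`. -/
theorem half_le_edgeLaw_exists_touches (hV : Pairwise (Function.onFun Disjoint V))
    (p : unitInterval) (e : Hyperedge n) (A : Finset (Fin k))
    (hA : 6 ≤ ∑ j ∈ A, hitProb p (e ∩ V j).card) :
    1 / 2 ≤ (edgeLaw n p).real {ζ | ∃ i ∈ A, Touches (keptPart ζ e) (V i)} := by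
  set μ := ∑ j ∈ A, hitProb p (e ∩ V j).card with hμ
  set U : Finset (Fin k) → Finset (Fin n) := fun B => B.biUnion fun j => e ∩ V j with hU
  -- If some `V i` is hit but not touched, the whole fingerprint lies inside `V i`. So failure means
  -- that no component of `A` is hit, or that exactly one is.
  have hsub : {ζ : Fin n → Bool | ∃ i ∈ A, Touches (keptPart ζ e) (V i)}ᶜ ⊆
      {ζ | ∀ v ∈ U A, ζ v = false} ∪
        ⋃ i ∈ A, {ζ | (∃ v ∈ e ∩ V i, ζ v = true) ∧ ∀ v ∈ U (A.erase i), ζ v = false} := by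
    intro ζ hζ
    simp only [Set.mem_compl_iff, Set.mem_ofPred_eq, not_exists, not_and,
      touches_keptPart_iff] at hζ
    by_cases h : ∃ i ∈ A, ∃ v ∈ e ∩ V i, ζ v = true
    · obtain ⟨i, hi, hv⟩ := h
      refine Or.inr (Set.mem_biUnion hi ⟨hv, fun w hw => ?_⟩)
      simp only [hU, Finset.mem_biUnion, Finset.mem_erase, Finset.mem_inter] at hw
      obtain ⟨j, ⟨hji, -⟩, hwe, hwj⟩ := hw
      have := hζ i hi hv w
        (Finset.mem_sdiff.2 ⟨hwe, Finset.disjoint_left.1 (hV hji) hwj⟩)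
      simpa using this
    · push Not at h
      refine Or.inl fun v hv => ?_
      simp only [hU, Finset.mem_biUnion] at hv
      obtain ⟨j, hj, hvj⟩ := hv
      simpa using h j hj v hvj
  have hbound : (edgeLaw n p).real {ζ : Fin n → Bool | ∃ i ∈ A, Touches (keptPart ζ e) (V i)}ᶜ ≤
      Real.exp (-μ) + μ * Real.exp (1 - μ) := by
    refine (measureReal_mono hsub).trans ((measureReal_union_le _ _).trans (add_le_add ?_ ?_))
    · rw [edgeLaw_miss, pow_card_biUnion hV]
      exact prod_one_sub_le_exp A _ fun j _ => hitProb_le_one _ _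
    · refine (measureReal_biUnion_finset_le _ _).trans ?_
      rw [hμ, Finset.sum_mul]
      refine Finset.sum_le_sum fun i hi => ?_
      rw [edgeLaw_hit_miss]
      · refine mul_le_mul_of_nonneg_left ?_ (hitProb_nonneg _ _)
        rw [pow_card_biUnion hV]
        refine (prod_one_sub_le_exp _ _ fun j _ => hitProb_le_one _ _).trans
          (Real.exp_le_exp.2 ?_)
        rw [← Finset.add_sum_erase _ _ hi]
        linarith [hitProb_le_one p (e ∩ V i).card]
      · refine Finset.disjoint_left.2 fun v h1 h2 => ?_
        simp only [hU, Finset.mem_biUnion, Finset.mem_erase, Finset.mem_inter] at h1 h2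
        obtain ⟨j, ⟨hji, -⟩, -, hvj⟩ := h2
        exact Finset.disjoint_left.1 (hV hji) hvj h1.2
  rw [probReal_compl_eq_one_sub (.of_discrete)] at hbound
  -- The failure bound is at most `(1 + μ) y²` with `y = exp((1 - μ)/2)`. Since `(1 + μ) y ≤ 2` and
  -- `y ≤ 1/8` for `μ ≥ 6`, it is at most `1/4`.
  have h2 : (1 : ℝ) / 2 ≤ 1 - (Real.exp (-μ) + μ * Real.exp (1 - μ)) := by
    set y := Real.exp ((1 - μ) / 2) with hy
    have hy0 : 0 < y := Real.exp_pos _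
    have e1 : Real.exp (1 - μ) = y * y := by rw [hy, ← Real.exp_add]; ring_nf
    have e2 : Real.exp (-μ) ≤ y * y := by
      rw [← e1]; exact Real.exp_le_exp.2 (by linarith)
    have e3 : y * ((1 + μ) / 2) ≤ 1 := by
      have := Real.add_one_le_exp ((μ - 1) / 2)
      have h5 : y * Real.exp ((μ - 1) / 2) = 1 := by
        rw [hy, ← Real.exp_add]; ring_nf; exact Real.exp_zero
      nlinarith
    have e4 : y ≤ 1 / 8 := by
      have h7 : Real.exp ((1 - μ) / 2) ≤ Real.exp (-(5 / 2)) := Real.exp_le_exp.2 (by linarith)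
      have h8 : Real.exp (-(5 / 2)) = (Real.exp (-(5 / 4))) * (Real.exp (-(5/4))) := by
        rw [← Real.exp_add]; norm_num
      have h9 : (17 / 6 : ℝ) ≤ Real.exp (5 / 4) := by
        have h10 := Real.sum_le_exp_of_nonneg (x := 5 / 4) (by norm_num) 5
        norm_num [Finset.sum_range_succ, Nat.factorial] at h10
        linarith
      have h11 : Real.exp (-(5 / 4)) * Real.exp (5 / 4) = 1 := by
        rw [← Real.exp_add]; norm_num
      have h12 := Real.exp_pos (-(5 / 4))
      nlinarith
    nlinarith
  linarith

end EdgeLaw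

/-! ### Component sums of the incidence encoding -/

section Incidence

variable {n : ℕ}

theorem sum_incidenceEntry (e : Hyperedge n) (he : e.Nonempty) (W : Finset (Fin n)) :
    ∑ v ∈ W, incidenceEntry v e =
      ((e ∩ W).card : ℤ) - if e.max' he ∈ W then (e.card : ℤ) else 0 := by
  have h1 : ∀ v, incidenceEntry v e =
      (if v ∈ e then (1 : ℤ) else 0) - if v = e.max' he then (e.card : ℤ) else 0 := by
    intro v
    have hmax : v ∈ e → ((∀ w ∈ e, w ≤ v) ↔ v = e.max' he) := fun hv =>
      ⟨fun h => le_antisymm (e.le_max' v hv) (e.max'_le he v h),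
        fun h w hw => h ▸ e.le_max' w hw⟩
    unfold incidenceEntry
    by_cases hv : v ∈ e
    · simp only [hv, if_true, hmax hv]
      split_ifs <;> ring
    · have : v ≠ e.max' he := fun h => hv (h ▸ e.max'_mem he)
      simp [hv, this]
  simp_rw [h1]
  rw [Finset.sum_sub_distrib, Finset.sum_ite_eq', ← Finset.sum_filter, Finset.sum_const,
    Finset.filter_mem_eq_inter, Finset.inter_comm]
  simp

/-- The sum is `|e ∩ W|`, reduced by `|e|` if the maximum of `e` is in `W`. It vanishes only if the
side of `W` without the maximum contains no vertex of `e`, so hyperedges lying inside or outside `W`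
cancel and all others survive. -/
theorem sum_incidenceEntry_ne_zero_iff (e : Hyperedge n) (W : Finset (Fin n)) :
    ∑ v ∈ W, incidenceEntry v e ≠ 0 ↔ Touches e W := by
  rcases e.eq_empty_or_nonempty with rfl | he
  · simp [incidenceEntry, Touches]
  rw [sum_incidenceEntry e he W, Touches]
  have hcard := Finset.card_sdiff_add_card_inter e W
  by_cases h : e.max' he ∈ W
  · have h2 : (e ∩ W).Nonempty := ⟨_, Finset.mem_inter.2 ⟨e.max'_mem he, h⟩⟩
    rw [if_pos h, ← Finset.card_pos (s := e \ W)]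
    simp only [h2, true_and]
    omega
  · have h2 : (e \ W).Nonempty := ⟨_, Finset.mem_sdiff.2 ⟨e.max'_mem he, h⟩⟩
    rw [if_neg h, ← Finset.card_pos (s := e ∩ W)]
    simp only [h2, and_true]
    omega

theorem abs_sum_incidenceEntry_le (e : Hyperedge n) (W : Finset (Fin n)) :
    |∑ v ∈ W, incidenceEntry v e| ≤ (n : ℤ) := by
  rcases e.eq_empty_or_nonempty with rfl | he
  · simp [incidenceEntry]
  rw [sum_incidenceEntry e he W, abs_le]
  have h1 : (e ∩ W).card ≤ e.card := Finset.card_le_card Finset.inter_subset_left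
  have h2 : e.card ≤ n := by simpa using Finset.card_le_univ e
  split_ifs <;> constructor <;> omega

/-- The sketched vector of the component `W` after the hyperedges in `S` have been subtracted. -/
def residualVector (H S : Finset (Hyperedge n)) (F : Coins n) (W : Finset (Fin n)) :
    Hyperedge n → ℤ :=
  ∑ v ∈ W, (neighborhoodVector H F v - neighborhoodVector S F v)

theorem residualVector_apply {H S : Finset (Hyperedge n)} (hS : S ⊆ H) (F : Coins n)
    (W : Finset (Fin n)) (e : Hyperedge n) :
    residualVector H S F W e =
      if e ∈ H \ S then ∑ v ∈ W, incidenceEntry v (fingerprint F e) else 0 := by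
  simp only [residualVector, Finset.sum_apply, Pi.sub_apply, neighborhoodVector]
  by_cases h1 : e ∈ S
  · simp [h1, hS h1]
  · by_cases h2 : e ∈ H <;> simp [h1, h2]

/-- The hyperedges of `H'` whose fingerprint touches `W`. -/
def touching (H' : Finset (Hyperedge n)) (F : Coins n) (W : Finset (Fin n)) :
    Finset (Hyperedge n) :=
  H'.filter fun e => Touches (fingerprint F e) W

theorem residualVector_ne_zero_iff {H S : Finset (Hyperedge n)} (hS : S ⊆ H) (F : Coins n)
    (W : Finset (Fin n)) (e : Hyperedge n) :
    residualVector H S F W e ≠ 0 ↔ e ∈ touching (H \ S) F W := by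
  rw [residualVector_apply hS, touching, Finset.mem_filter, ← sum_incidenceEntry_ne_zero_iff]
  by_cases h : e ∈ H \ S <;> simp [h]

theorem filter_residualVector_ne_zero {H S : Finset (Hyperedge n)} (hS : S ⊆ H) (F : Coins n)
    (W : Finset (Fin n)) :
    (Finset.univ.filter fun e => residualVector H S F W e ≠ 0) = touching (H \ S) F W := by
  ext e
  simp [← residualVector_ne_zero_iff hS]

theorem abs_residualVector_le {H S : Finset (Hyperedge n)} (hS : S ⊆ H) (F : Coins n)
    (W : Finset (Fin n)) (e : Hyperedge n) : |residualVector H S F W e| ≤ (n : ℤ) := by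
  rw [residualVector_apply hS]
  split_ifs
  · exact abs_sum_incidenceEntry_le _ _
  · simp

end Incidence

/-! ### One layer: which hyperedge a component receives -/

section Layer

variable {n m : ℕ} {δ : ℝ} {Seed : Type*} [MeasurableSpace Seed] {Sk : Type*} [AddCommGroup Sk]

/-- What the sampler returns in one layer for the component `W`, after the hyperedges in `S` have
been subtracted. -/
def opened (A : L0Sampler (Hyperedge n) Seed Sk n m δ) (H S : Finset (Hyperedge n))
    (W : Finset (Fin n)) (ω : Coins n × Seed) : Option (Hyperedge n) :=
  A.output ω.2 (A.sketch ω.2 (residualVector H S ω.1 W))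

/-- The law of the public randomness of one layer. -/
def layerLaw (A : L0Sampler (Hyperedge n) Seed Sk n m δ) (p : unitInterval) :
    Measure (Coins n × Seed) :=
  (coinLaw n p).prod A.law

instance (A : L0Sampler (Hyperedge n) Seed Sk n m δ) : IsProbabilityMeasure A.law :=
  A.isProbabilityMeasure_law

instance (A : L0Sampler (Hyperedge n) Seed Sk n m δ) (p : unitInterval) :
    IsProbabilityMeasure (layerLaw A p) := by
  unfold layerLaw; infer_instance

theorem measurableSet_of_sections {α β : Type*} [MeasurableSpace α] [Finite α]
    [MeasurableSingletonClass α] [MeasurableSpace β] {s : Set (α × β)}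
    (h : ∀ a, MeasurableSet {b | (a, b) ∈ s}) : MeasurableSet s := by
  have : s = ⋃ a, {a} ×ˢ {b | (a, b) ∈ s} := by
    ext ⟨a, b⟩; simp
  rw [this]
  exact MeasurableSet.iUnion fun a => (measurableSet_singleton a).prod (h a)

theorem measureReal_prod_eq_integral {α β : Type*} [MeasurableSpace α] [Finite α]
    [MeasurableSingletonClass α] [MeasurableSpace β] (μ : Measure α) (ρ : Measure β)
    [IsProbabilityMeasure μ] [IsProbabilityMeasure ρ] {s : Set (α × β)} (hs : MeasurableSet s) :
    (μ.prod ρ).real s = ∫ a, ρ.real {b | (a, b) ∈ s} ∂μ := by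
  rw [← integral_indicator_one hs, integral_prod]
  · refine integral_congr_ae (Filter.Eventually.of_forall fun a => ?_)
    exact integral_indicator_one (measurable_prodMk_left hs)
  · exact (integrable_indicator_iff hs).2 (integrable_const (1 : ℝ)).integrableOn

variable (A : L0Sampler (Hyperedge n) Seed Sk n m δ) {H S : Finset (Hyperedge n)}

theorem measurableSet_opened (H S : Finset (Hyperedge n)) (W : Finset (Fin n)) (e : Hyperedge n) :
    MeasurableSet {ω | opened A H S W ω = some e} :=
  measurableSet_of_sections fun F => A.measurableSet_output (residualVector H S F W) e

theorem measurableSet_coins (Q : Coins n → Prop) :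
    MeasurableSet {ω : Coins n × Seed | Q ω.1} :=
  measurable_fst (MeasurableSet.of_discrete (s := {F | Q F}))

theorem law_output_eq_none_le (hS : S ⊆ H) (hm : H.card ≤ m) (F : Coins n) (W : Finset (Fin n))
    (hne : (touching (H \ S) F W).Nonempty) :
    A.law.real {R | A.output R (A.sketch R (residualVector H S F W)) = none} ≤ δ := by
  refine A.failure_le _ ?_ (abs_residualVector_le hS F W) ?_
  · obtain ⟨e, he⟩ := hne
    intro h0
    exact (residualVector_ne_zero_iff hS F W e).2 he (by rw [h0]; rfl)
  · rw [filter_residualVector_ne_zero hS]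
    exact ((Finset.card_filter_le _ _).trans (Finset.card_le_card Finset.sdiff_subset)).trans hm

theorem law_output_eq_some (hS : S ⊆ H) (hm : H.card ≤ m) (F : Coins n) (W : Finset (Fin n))
    (hne : (touching (H \ S) F W).Nonempty) (e : Hyperedge n) [Decidable (e ∈ touching (H \ S) F W)] :
    A.law.real {R | A.output R (A.sketch R (residualVector H S F W)) = some e} =
      A.law.real {R | A.output R (A.sketch R (residualVector H S F W)) ≠ none} *
        if e ∈ touching (H \ S) F W then 1 / ((touching (H \ S) F W).card : ℝ) else 0 := by
  rw [A.uniform _ ?_ (abs_residualVector_le hS F W) ?_, filter_residualVector_ne_zero hS]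
  · congr 1
    by_cases h : e ∈ touching (H \ S) F W
    · rw [if_pos h, if_neg ((residualVector_ne_zero_iff hS F W e).2 h)]
    · rw [if_neg h, if_pos (by_contra fun h2 => h ((residualVector_ne_zero_iff hS F W e).1 h2)),
        zero_div]
  · obtain ⟨e, he⟩ := hne
    intro h0
    exact (residualVector_ne_zero_iff hS F W e).2 he (by rw [h0]; rfl)
  · rw [filter_residualVector_ne_zero hS]
    exact ((Finset.card_filter_le _ _).trans (Finset.card_le_card Finset.sdiff_subset)).trans hm

theorem residualVector_eq_zero (hS : S ⊆ H) (F : Coins n) (W : Finset (Fin n))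
    (h : ¬ (touching (H \ S) F W).Nonempty) : residualVector H S F W = 0 := by
  funext e
  by_contra h2
  exact h ⟨e, (residualVector_ne_zero_iff hS F W e).1 h2⟩

theorem opened_eq_none_of_touching_empty (hS : S ⊆ H) (W : Finset (Fin n)) (ω : Coins n × Seed)
    (h : ¬ (touching (H \ S) ω.1 W).Nonempty) : opened A H S W ω = none := by
  rw [opened, residualVector_eq_zero hS _ _ h, map_zero, A.output_zero]

open Classical in
/-- The share of the hyperedge `e` in the support of the residual vector of `W`. -/
def supportShare (H' : Finset (Hyperedge n)) (W : Finset (Fin n)) (e : Hyperedge n) (F : Coins n) :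
    ℝ :=
  if e ∈ touching H' F W then 1 / ((touching H' F W).card : ℝ) else 0

theorem law_opened_le (hS : S ⊆ H) (hm : H.card ≤ m) (F : Coins n) (W : Finset (Fin n))
    (e : Hyperedge n) :
    A.law.real {R | opened A H S W (F, R) = some e} ≤ supportShare (H \ S) W e F := by
  classical
  by_cases hne : (touching (H \ S) F W).Nonempty
  · refine (law_output_eq_some A hS hm F W hne e).le.trans ?_
    rw [supportShare]
    refine mul_le_of_le_one_left ?_ measureReal_le_one
    split_ifs <;> positivity
  · have : {R | opened A H S W (F, R) = some e} = ∅ := by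
      ext R
      simp [opened_eq_none_of_touching_empty A hS W (F, R) hne]
    rw [this, measureReal_empty, supportShare]
    split_ifs <;> positivity

theorem le_law_opened (hδ : δ ≤ 1 / 2) (hS : S ⊆ H) (hm : H.card ≤ m) (F : Coins n)
    (W : Finset (Fin n)) (e : Hyperedge n) :
    1 / 2 * supportShare (H \ S) W e F ≤ A.law.real {R | opened A H S W (F, R) = some e} := by
  classical
  by_cases hne : (touching (H \ S) F W).Nonempty
  · refine le_trans ?_ (law_output_eq_some A hS hm F W hne e).ge
    rw [supportShare]
    refine mul_le_mul_of_nonneg_right ?_ (by split_ifs <;> positivity)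
    have h1 : {R | A.output R (A.sketch R (residualVector H S F W)) ≠ none} =
        ⋃ e, {R | A.output R (A.sketch R (residualVector H S F W)) = some e} := by
      ext R; simp [Option.ne_none_iff_exists']
    have h2 : MeasurableSet {R | A.output R (A.sketch R (residualVector H S F W)) ≠ none} := by
      rw [h1]
      exact MeasurableSet.iUnion fun e => A.measurableSet_output _ e
    have h3 := law_output_eq_none_le A hS hm F W hne
    have h4 : {R | A.output R (A.sketch R (residualVector H S F W)) = none} =
        {R | A.output R (A.sketch R (residualVector H S F W)) ≠ none}ᶜ := by
      ext R; simp
    rw [h4, probReal_compl_eq_one_sub h2] at h3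
    linarith
  · rw [supportShare, if_neg fun h => hne ⟨e, h⟩, mul_zero]
    exact measureReal_nonneg

/-- The expected number of hyperedges of `H'` whose fingerprint touches `W`. -/
def expectedDegree (H' : Finset (Hyperedge n)) (p : ℝ) (W : Finset (Fin n)) : ℝ :=
  ∑ e ∈ H', touchProb p e W

/-- The expected share of a touching hyperedge, when `H''` are the other hyperedges. -/
def meanShare (H'' : Finset (Hyperedge n)) (p : unitInterval) (W : Finset (Fin n)) : ℝ :=
  ∫ F, 1 / (1 + ((touching H'' F W).card : ℝ)) ∂coinLaw n p

theorem card_touching_update (H' : Finset (Hyperedge n)) (W : Finset (Fin n)) (e : Hyperedge n)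
    (F : Coins n) (ζ : Fin n → Bool) :
    touching (H'.erase e) (Function.update F e ζ) W = touching (H'.erase e) F W := by
  refine Finset.filter_congr fun e' he' => ?_
  rw [fingerprint_eq, fingerprint_eq, Function.update_of_ne (Finset.ne_of_mem_erase he')]

theorem mem_touching {H' : Finset (Hyperedge n)} {F : Coins n} {W : Finset (Fin n)}
    {e : Hyperedge n} : e ∈ touching H' F W ↔ e ∈ H' ∧ Touches (keptPart (F e) e) W := by
  rw [touching, Finset.mem_filter, fingerprint_eq]

theorem card_touching_erase {H' : Finset (Hyperedge n)} {F : Coins n} {W : Finset (Fin n)}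
    {e : Hyperedge n} (he : e ∈ touching H' F W) :
    (touching H' F W).card = 1 + (touching (H'.erase e) F W).card := by
  have : touching (H'.erase e) F W = (touching H' F W).erase e := by
    ext e'; simp only [mem_touching, Finset.mem_erase]; tauto
  rw [this, Finset.card_erase_of_mem he]
  have := Finset.card_pos.2 ⟨e, he⟩
  omega

/-- When `e` touches `W`, its share is `1 / (1 + X)`, where `X` counts the other touching
hyperedges. `X` depends only on the coins of the others, hence is independent of the coins of `e`,
and the expectation factors. -/
theorem integral_indicator_mul_supportShare {H' : Finset (Hyperedge n)} (p : unitInterval)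
    (W : Finset (Fin n)) {e : Hyperedge n} (he : e ∈ H') (Q : Set (Fin n → Bool)) :
    ∫ F, Q.indicator 1 (F e) * supportShare H' W e F ∂coinLaw n p =
      (edgeLaw n p).real (Q ∩ {ζ | Touches (keptPart ζ e) W}) * meanShare (H'.erase e) p W := by
  classical
  rw [← integral_indicator_one (.of_discrete), meanShare, coinLaw_eq,
    ← integral_pi_mul_of_update_eq (fun _ => edgeLaw n p) e _ _
      fun F ζ => by rw [card_touching_update]]
  refine integral_congr_ae (Filter.Eventually.of_forall fun F => ?_)
  dsimp only
  rw [supportShare]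
  by_cases h : e ∈ touching H' F W
  · rw [if_pos h, card_touching_erase h]
    have h2 := (mem_touching.1 h).2
    by_cases hQ : F e ∈ Q <;> simp [hQ, h2]
  · have h2 : ¬ Touches (keptPart (F e) e) W := fun h2 => h (mem_touching.2 ⟨he, h2⟩)
    simp [if_neg h, h2]

theorem layerLaw_real_eq (p : unitInterval) (W : Finset (Fin n)) (e : Hyperedge n)
    (Q : Set (Fin n → Bool)) :
    (layerLaw A p).real {ω | ω.1 e ∈ Q ∧ opened A H S W ω = some e} =
      ∫ F, Q.indicator 1 (F e) * A.law.real {R | opened A H S W (F, R) = some e}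
        ∂coinLaw n p := by
  have hms : MeasurableSet {ω | ω.1 e ∈ Q ∧ opened A H S W ω = some e} :=
    (measurableSet_coins fun F => F e ∈ Q).inter (measurableSet_opened A H S W e)
  rw [layerLaw, measureReal_prod_eq_integral _ _ hms]
  refine integral_congr_ae (Filter.Eventually.of_forall fun F => ?_)
  by_cases hQ : F e ∈ Q <;> simp [hQ]

theorem layerLaw_opened_le (hS : S ⊆ H) (hm : H.card ≤ m) (p : unitInterval)
    (W : Finset (Fin n)) {e : Hyperedge n} (he : e ∈ H \ S) (Q : Set (Fin n → Bool)) :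
    (layerLaw A p).real {ω | ω.1 e ∈ Q ∧ opened A H S W ω = some e} ≤
      (edgeLaw n p).real (Q ∩ {ζ | Touches (keptPart ζ e) W}) *
        meanShare ((H \ S).erase e) p W := by
  rw [layerLaw_real_eq, ← integral_indicator_mul_supportShare p W he Q]
  exact integral_mono .of_finite .of_finite fun F =>
    mul_le_mul_of_nonneg_left (law_opened_le A hS hm F W e)
      (Set.indicator_nonneg (fun _ _ => zero_le_one) _)

theorem le_layerLaw_opened (hδ : δ ≤ 1 / 2) (hS : S ⊆ H) (hm : H.card ≤ m) (p : unitInterval)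
    (W : Finset (Fin n)) {e : Hyperedge n} (he : e ∈ H \ S) (Q : Set (Fin n → Bool)) :
    1 / 2 * ((edgeLaw n p).real (Q ∩ {ζ | Touches (keptPart ζ e) W}) *
        meanShare ((H \ S).erase e) p W) ≤
      (layerLaw A p).real {ω | ω.1 e ∈ Q ∧ opened A H S W ω = some e} := by
  rw [layerLaw_real_eq, ← integral_indicator_mul_supportShare p W he Q, ← integral_const_mul]
  refine integral_mono .of_finite .of_finite fun F => ?_
  have h0 : 0 ≤ Q.indicator (1 : (Fin n → Bool) → ℝ) (F e) :=
    Set.indicator_nonneg (fun _ _ => zero_le_one) _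
  have := mul_le_mul_of_nonneg_left (le_law_opened A hδ hS hm F W e) h0
  dsimp only
  linarith

theorem meanShare_nonneg (H'' : Finset (Hyperedge n)) (p : unitInterval) (W : Finset (Fin n)) :
    0 ≤ meanShare H'' p W := integral_nonneg fun F => by positivity

theorem integral_card_touching (H' : Finset (Hyperedge n)) (p : unitInterval)
    (W : Finset (Fin n)) :
    ∫ F, ((touching H' F W).card : ℝ) ∂coinLaw n p = expectedDegree H' p W := by
  classical
  have h1 : ∀ F : Coins n, ((touching H' F W).card : ℝ) =
      ∑ e ∈ H', {ζ | Touches (keptPart ζ e) W}.indicator 1 (F e) * (1 : ℝ) := by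
    intro F
    rw [touching, Finset.card_filter]
    push_cast
    refine Finset.sum_congr rfl fun e _ => ?_
    by_cases h : Touches (keptPart (F e) e) W <;> simp [fingerprint_eq, h]
  simp_rw [h1]
  rw [integral_finsetSum _ fun e _ => .of_finite, expectedDegree]
  refine Finset.sum_congr rfl fun e _ => ?_
  rw [coinLaw_eq, integral_pi_mul_of_update_eq (fun _ => edgeLaw n p) e _ (fun _ => 1)
    (fun _ _ => rfl), integral_indicator_one (.of_discrete), edgeLaw_touches]
  simp

theorem expectedDegree_nonneg (H' : Finset (Hyperedge n)) (p : unitInterval)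
    (W : Finset (Fin n)) : 0 ≤ expectedDegree H' p W :=
  Finset.sum_nonneg fun e _ => touchProb_nonneg p e W

/-- Jensen's inequality for the convex function `x ↦ 1 / (1 + x)`. -/
theorem le_meanShare (H'' : Finset (Hyperedge n)) (p : unitInterval) (W : Finset (Fin n)) {B : ℝ}
    (hB : expectedDegree H'' p W ≤ B) : 1 / (1 + B) ≤ meanShare H'' p W := by
  have hB0 : 0 < 1 + B := by linarith [expectedDegree_nonneg H'' p W]
  -- The graph lies above its tangent at `x = B`.
  have h1 : ∀ F : Coins n, 1 / (1 + B) + B / (1 + B) ^ 2 -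
      1 / (1 + B) ^ 2 * ((touching H'' F W).card : ℝ) ≤
        1 / (1 + ((touching H'' F W).card : ℝ)) := by
    intro F
    set x : ℝ := ((touching H'' F W).card : ℝ)
    have hx : 0 < 1 + x := by positivity
    rw [le_div_iff₀ hx]
    have : (1 / (1 + B) + B / (1 + B) ^ 2 - 1 / (1 + B) ^ 2 * x) * (1 + x) =
        1 - ((x - B) / (1 + B)) ^ 2 := by field_simp; ring
    rw [this]
    linarith [sq_nonneg ((x - B) / (1 + B))]
  have h2 := integral_mono (μ := coinLaw n p) Integrable.of_finite Integrable.of_finite h1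
  rw [integral_sub .of_finite .of_finite, integral_const_mul, integral_card_touching] at h2
  simp only [integral_const, probReal_univ, smul_eq_mul, one_mul] at h2
  refine le_trans ?_ h2
  have h3 : 1 / (1 + B) ^ 2 * expectedDegree H'' p W ≤ 1 / (1 + B) ^ 2 * B :=
    mul_le_mul_of_nonneg_left hB (by positivity)
  have h4 : 1 / (1 + B) ^ 2 * B = B / (1 + B) ^ 2 := by ring
  linarith

/-- The shares of the touching hyperedges add up to `1` whenever there is one, and to `0` otherwise.
This identity replaces a concentration bound for the degree. -/
theorem sum_touchProb_mul_meanShare (H' : Finset (Hyperedge n)) (p : unitInterval)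
    (W : Finset (Fin n)) :
    ∑ e ∈ H', touchProb p e W * meanShare (H'.erase e) p W =
      (coinLaw n p).real {F | (touching H' F W).Nonempty} := by
  classical
  have h1 : ∀ e ∈ H', touchProb p e W * meanShare (H'.erase e) p W =
      ∫ F, supportShare H' W e F ∂coinLaw n p := by
    intro e he
    have := integral_indicator_mul_supportShare p W he Set.univ
    simp only [Set.indicator_univ, Pi.one_apply, one_mul, Set.univ_inter] at this
    rw [this, edgeLaw_touches]
  rw [Finset.sum_congr rfl h1, ← integral_finsetSum _ fun e _ => .of_finite,
    ← integral_indicator_one (.of_discrete)]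
  refine integral_congr_ae (Filter.Eventually.of_forall fun F => ?_)
  have hsub : touching H' F W ⊆ H' := Finset.filter_subset _ _
  simp only [supportShare]
  rw [Finset.sum_ite_mem, Finset.inter_eq_right.2 hsub, Finset.sum_const, nsmul_eq_mul]
  by_cases h : (touching H' F W).Nonempty
  · have : ((touching H' F W).card : ℝ) ≠ 0 := by
      exact_mod_cast (Finset.card_pos.2 h).ne'
    simp [h, this]
  · rw [Finset.not_nonempty_iff_eq_empty.1 h]
    simp [Finset.not_nonempty_iff_eq_empty.1 h]

/-- Putting `e` back only lowers the mean share, so the sum in `sum_touchProb_mul_meanShare`, a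
probability, dominates the left side. -/
theorem expectedDegree_mul_meanShare_le (H' : Finset (Hyperedge n)) (p : unitInterval)
    (W : Finset (Fin n)) : expectedDegree H' p W * meanShare H' p W ≤ 1 := by
  refine le_trans ?_ (measureReal_le_one (μ := coinLaw n p)
    (s := {F | (touching H' F W).Nonempty}))
  rw [← sum_touchProb_mul_meanShare, expectedDegree, Finset.sum_mul]
  refine Finset.sum_le_sum fun e _ => mul_le_mul_of_nonneg_left ?_ (touchProb_nonneg p e W)
  refine integral_mono .of_finite .of_finite fun F => ?_
  refine one_div_le_one_div_of_le (by positivity) ?_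
  have : (touching (H'.erase e) F W).card ≤ (touching H' F W).card := by
    refine Finset.card_le_card fun e' he' => ?_
    rw [mem_touching] at he' ⊢
    exact ⟨Finset.mem_of_mem_erase he'.1, he'.2⟩
  have : ((touching (H'.erase e) F W).card : ℝ) ≤ (touching H' F W).card := by exact_mod_cast this
  linarith

/-- Removing one hyperedge lowers the count by at most one and so at most doubles `1 / (1 + X)`.
With a large expected degree this makes each individual share small. -/
theorem meanShare_erase_le (H' : Finset (Hyperedge n)) (p : unitInterval) (W : Finset (Fin n))
    (e : Hyperedge n) : expectedDegree H' p W * meanShare (H'.erase e) p W ≤ 2 := by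
  have h1 : meanShare (H'.erase e) p W ≤ 2 * meanShare H' p W := by
    rw [meanShare, meanShare, ← integral_const_mul]
    refine integral_mono .of_finite .of_finite fun F => ?_
    have : (touching H' F W).card ≤ 1 + (touching (H'.erase e) F W).card := by
      by_cases h : e ∈ touching H' F W
      · exact (card_touching_erase h).le
      · refine le_add_left (Finset.card_le_card fun e' he' => ?_)
        have h2 := mem_touching.1 he'
        exact mem_touching.2 ⟨Finset.mem_erase.2 ⟨fun h3 => h (h3 ▸ he'), h2.1⟩, h2.2⟩
    have h3 : ((touching H' F W).card : ℝ) ≤ 1 + (touching (H'.erase e) F W).card := by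
      exact_mod_cast this
    dsimp only
    rw [mul_one_div, div_le_div_iff₀ (by positivity) (by positivity)]
    have : (0 : ℝ) ≤ (touching (H'.erase e) F W).card := by positivity
    linarith
  have := expectedDegree_mul_meanShare_le H' p W
  nlinarith [expectedDegree_nonneg H' p W]

/-- The indicator of `X = 0` is at most `1 / (1 + X)`, whose mean is at most the inverse of the
expected degree. -/
theorem one_sub_le_coinLaw_touching (H' : Finset (Hyperedge n)) (p : unitInterval)
    (W : Finset (Fin n)) (hD : 0 < expectedDegree H' p W) :
    1 - 1 / expectedDegree H' p W ≤ (coinLaw n p).real {F | (touching H' F W).Nonempty} := by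
  have h1 : (coinLaw n p).real {F | (touching H' F W).Nonempty}ᶜ ≤ meanShare H' p W := by
    rw [← integral_indicator_one (.of_discrete), meanShare]
    refine integral_mono .of_finite .of_finite fun F => ?_
    by_cases h : (touching H' F W).Nonempty
    · simp only [Set.indicator_of_notMem (s := {F | (touching H' F W).Nonempty}ᶜ) (fun h2 => h2 h)]
      positivity
    · simp [Finset.not_nonempty_iff_eq_empty.1 h]
  rw [probReal_compl_eq_one_sub (.of_discrete)] at h1
  have h2 := expectedDegree_mul_meanShare_le H' p W
  have h3 : meanShare H' p W ≤ 1 / expectedDegree H' p W := by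
    rw [le_div_iff₀ hD]; linarith
  linarith

theorem layerLaw_opened_invalid (hS : S ⊆ H) (hm : H.card ≤ m) (p : unitInterval)
    (W : Finset (Fin n)) (e : Hyperedge n) :
    layerLaw A p {ω | opened A H S W ω = some e ∧ e ∉ touching (H \ S) ω.1 W} = 0 := by
  have hms : MeasurableSet {ω | opened A H S W ω = some e ∧ e ∉ touching (H \ S) ω.1 W} :=
    (measurableSet_opened A H S W e).inter (measurableSet_coins fun F => e ∉ touching (H \ S) F W)
  rw [← measureReal_eq_zero_iff, layerLaw, measureReal_prod_eq_integral _ _ hms]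
  refine integral_eq_zero_of_ae (Filter.Eventually.of_forall fun F => ?_)
  by_cases h : e ∈ touching (H \ S) F W
  · simp [h]
  · have h1 := law_opened_le A hS hm F W e
    rw [supportShare, if_neg h] at h1
    simp only [Set.mem_ofPred_eq, h, not_false_eq_true, and_true]
    exact le_antisymm h1 measureReal_nonneg

variable {k : ℕ} {V : Fin k → Finset (Fin n)}

/-- A component of large expected degree is likely to receive a hyperedge whose fingerprint
touches few components. -/
theorem quarter_le_layerLaw_good (hδ : δ ≤ 1 / 2) (hS : S ⊆ H) (hm : H.card ≤ m)
    (hV : Pairwise (Function.onFun Disjoint V)) (p : unitInterval) (B : Finset (Fin k))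
    (hB : ∀ e ∈ H \ S, ∑ j ∈ B, hitProb p (e ∩ V j).card ≤ 12) {i : Fin k} (hi : i ∈ B)
    (hD : 4 ≤ expectedDegree (H \ S) p (V i)) :
    1 / 4 ≤ (layerLaw A p).real {ω | ∃ e, touchCount V B (keptPart (ω.1 e) e) ≤ 140 ∧
      opened A H S (V i) ω = some e} := by
  classical
  set Q : Hyperedge n → Set (Fin n → Bool) := fun e => {ζ | touchCount V B (keptPart ζ e) ≤ 140}
  -- Given a touch of `V i`, more than 140 components of `B` are touched with probability at most
  -- `(2 + 12)/140 = 1/10`; the sampler costs another factor `1/2`. Summing gives `9/20 · (1 - 1/4)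
  -- ≥ 1/4`.
  have hpart : ∀ e ∈ H \ S, 9 / 20 * (touchProb p e (V i) * meanShare ((H \ S).erase e) p (V i)) ≤
      (layerLaw A p).real {ω | ω.1 e ∈ Q e ∧ opened A H S (V i) ω = some e} := by
    intro e he
    refine le_trans ?_ (le_layerLaw_opened A hδ hS hm p (V i) he (Q e))
    have h1 := edgeLaw_touches_crowded_le hV p e B hi 140
    have h2 := mul_le_mul_of_nonneg_right (hB e he) (touchProb_nonneg p e (V i))
    have h3 : touchProb p e (V i) ≤ (edgeLaw n p).real (Q e ∩ {ζ | Touches (keptPart ζ e) (V i)}) +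
        (edgeLaw n p).real
          {ζ | Touches (keptPart ζ e) (V i) ∧ 140 < touchCount V B (keptPart ζ e)} := by
      rw [← edgeLaw_touches]
      refine (measureReal_mono fun ζ hζ => ?_).trans (measureReal_union_le _ _)
      rcases le_or_gt (touchCount V B (keptPart ζ e)) 140 with h | h
      · exact Or.inl ⟨h, hζ⟩
      · exact Or.inr ⟨hζ, h⟩
    push_cast at h1
    have h4 : 9 / 10 * touchProb p e (V i) ≤
        (edgeLaw n p).real (Q e ∩ {ζ | Touches (keptPart ζ e) (V i)}) := by linarith
    have := mul_le_mul_of_nonneg_right h4 (meanShare_nonneg ((H \ S).erase e) p (V i))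
    linarith
  have hsum := Finset.sum_le_sum hpart
  rw [← Finset.mul_sum, sum_touchProb_mul_meanShare] at hsum
  have hpos := one_sub_le_coinLaw_touching (H \ S) p (V i) (by linarith)
  have hD' : 1 / expectedDegree (H \ S) p (V i) ≤ 1 / 4 :=
    one_div_le_one_div_of_le (by norm_num) hD
  rw [← measureReal_biUnion_finset] at hsum
  · have hsub : (⋃ e ∈ H \ S, {ω | ω.1 e ∈ Q e ∧ opened A H S (V i) ω = some e}) ⊆
        {ω | ∃ e, touchCount V B (keptPart (ω.1 e) e) ≤ 140 ∧ opened A H S (V i) ω = some e} := by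
      intro ω hω
      simp only [Set.mem_iUnion] at hω
      obtain ⟨e, -, h1, h2⟩ := hω
      exact ⟨e, h1, h2⟩
    have := measureReal_mono (μ := layerLaw A p) hsub
    linarith
  · intro e _ e' _ hne
    refine Set.disjoint_left.2 fun ω h1 h2 => hne ?_
    exact Option.some_injective _ (h1.2.symm.trans h2.2)
  · intro e _
    exact (measurableSet_coins fun F => F e ∈ Q e).inter (measurableSet_opened A H S (V i) e)

/-- A given hyperedge is rarely returned by components of large expected degree. -/
theorem layerLaw_exists_opened_le (hS : S ⊆ H) (hm : H.card ≤ m) (p : unitInterval)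
    (D : Finset (Fin k)) {B : ℝ} (hB0 : 0 < B)
    (hB : ∀ i ∈ D, B < expectedDegree (H \ S) p (V i)) {e : Hyperedge n} (he : e ∈ H \ S)
    (hD : ∑ j ∈ D, hitProb p (e ∩ V j).card ≤ 12) :
    (layerLaw A p).real {ω | ∃ i ∈ D, opened A H S (V i) ω = some e} ≤ 24 / B := by
  have hsub : {ω | ∃ i ∈ D, opened A H S (V i) ω = some e} ⊆
      ⋃ i ∈ D, {ω | ω.1 e ∈ Set.univ ∧ opened A H S (V i) ω = some e} := by
    rintro ω ⟨i, hi, h⟩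
    exact Set.mem_biUnion hi ⟨trivial, h⟩
  refine (measureReal_mono hsub (measure_ne_top _ _)).trans ((measureReal_biUnion_finset_le _ _).trans ?_)
  have h1 : ∀ i ∈ D, (layerLaw A p).real {ω | ω.1 e ∈ Set.univ ∧ opened A H S (V i) ω = some e} ≤
      hitProb p (e ∩ V i).card * (2 / B) := by
    intro i hi
    refine (layerLaw_opened_le A hS hm p (V i) he Set.univ).trans ?_
    rw [Set.univ_inter, edgeLaw_touches]
    refine mul_le_mul (touchProb_le_hitProb p e (V i)) ?_ (meanShare_nonneg _ _ _)
      (hitProb_nonneg _ _)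
    rw [le_div_iff₀ hB0]
    have h2 := meanShare_erase_le (H \ S) p (V i) e
    have h3 := mul_le_mul_of_nonneg_right (hB i hi).le
      (meanShare_nonneg ((H \ S).erase e) p (V i))
    linarith
  refine (Finset.sum_le_sum h1).trans ?_
  rw [← Finset.sum_mul]
  calc _ ≤ 12 * (2 / B) := mul_le_mul_of_nonneg_right hD (by positivity)
    _ = 24 / B := by ring

/-- A hyperedge is returned by some component of small expected degree with probability comparable
to the probability that it touches such a component. -/
theorem le_layerLaw_exists_opened (hδ : δ ≤ 1 / 2) (hS : S ⊆ H) (hm : H.card ≤ m)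
    (p : unitInterval) (D : Finset (Fin k)) {B : ℝ} (hB0 : 0 ≤ B)
    (hB : ∀ i ∈ D, expectedDegree (H \ S) p (V i) ≤ B) {e : Hyperedge n} (he : e ∈ H \ S) :
    (edgeLaw n p).real {ζ | ∃ i ∈ D, Touches (keptPart ζ e) (V i)} / (2 * (1 + B)) ≤
      (layerLaw A p).real {ω | ∃ i ∈ D, opened A H S (V i) ω = some e} := by
  -- The fingerprint is charged to the touched component of least index. This makes the events
  -- disjoint in `i`, so their probabilities add without any independence between the samplers of
  -- different components.
  set Q : Fin k → Set (Fin n → Bool) := fun i =>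
    {ζ | Touches (keptPart ζ e) (V i) ∧ ∀ j ∈ D, Touches (keptPart ζ e) (V j) → i ≤ j}
  have h1 : (edgeLaw n p).real {ζ | ∃ i ∈ D, Touches (keptPart ζ e) (V i)} ≤
      ∑ i ∈ D, (edgeLaw n p).real (Q i ∩ {ζ | Touches (keptPart ζ e) (V i)}) := by
    classical
    refine (measureReal_mono (fun ζ hζ => ?_) (measure_ne_top _ _)).trans
      (measureReal_biUnion_finset_le _ _)
    obtain ⟨i, hi, hti⟩ := hζ
    have hne : (D.filter fun i => Touches (keptPart ζ e) (V i)).Nonempty :=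
      ⟨i, Finset.mem_filter.2 ⟨hi, hti⟩⟩
    have hmin := Finset.mem_filter.1 (Finset.min'_mem _ hne)
    refine Set.mem_biUnion hmin.1 ⟨⟨hmin.2, fun j hj hj2 => ?_⟩, hmin.2⟩
    exact Finset.min'_le _ _ (Finset.mem_filter.2 ⟨hj, hj2⟩)
  have h2 : ∀ i ∈ D, (edgeLaw n p).real (Q i ∩ {ζ | Touches (keptPart ζ e) (V i)}) /
      (2 * (1 + B)) ≤ (layerLaw A p).real {ω | ω.1 e ∈ Q i ∧ opened A H S (V i) ω = some e} := by
    intro i hi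
    refine le_trans ?_ (le_layerLaw_opened A hδ hS hm p (V i) he (Q i))
    have h3 : expectedDegree ((H \ S).erase e) p (V i) ≤ B :=
      (Finset.sum_le_sum_of_subset_of_nonneg (Finset.erase_subset _ _)
        fun e _ _ => touchProb_nonneg p e (V i)).trans (hB i hi)
    have h4 := mul_le_mul_of_nonneg_left (le_meanShare _ p (V i) h3)
      (measureReal_nonneg (μ := edgeLaw n p) (s := Q i ∩ {ζ | Touches (keptPart ζ e) (V i)}))
    refine le_trans (le_of_eq ?_) (mul_le_mul_of_nonneg_left h4 (by norm_num : (0 : ℝ) ≤ 1 / 2))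
    field_simp
  have h3 := Finset.sum_le_sum h2
  rw [← Finset.sum_div, ← measureReal_biUnion_finset (μ := layerLaw A p)] at h3
  · refine (div_le_div_of_nonneg_right h1 (by positivity)).trans (h3.trans (measureReal_mono ?_))
    intro ω hω
    simp only [Set.mem_iUnion] at hω
    obtain ⟨i, hi, -, h⟩ := hω
    exact ⟨i, hi, h⟩
  · intro i hi j hj hne
    refine Set.disjoint_left.2 fun ω h1 h2 => hne ?_
    exact le_antisymm (h1.1.2 j hj h2.1.1) (h2.1.2 i hi h1.1.1)
  · intro i _
    exact (measurableSet_coins fun F => F e ∈ Q i).inter (measurableSet_opened A H S (V i) e)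

end Layer

/-! ### Unique representatives by Hall's theorem -/

section Representatives

variable {n k : ℕ} {V : Fin k → Finset (Fin n)}

/-- Every component outside `B` has `K` representatives in `S`. -/
def Served (V : Fin k → Finset (Fin n)) (K : ℕ) (S : Finset (Hyperedge n))
    (B : Finset (Fin k)) : Prop :=
  ∃ rep : Hyperedge n → Option (Fin k), (∀ e i, rep e = some i → Touches e (V i)) ∧
    ∀ i, i ∉ B → K ≤ (S.filter fun e => rep e = some i).card

/-- Representatives from different rounds do not conflict, because the hyperedges of the new round
are disjoint from those found before. -/
theorem Served.union {K : ℕ} {S F : Finset (Hyperedge n)} {B D : Finset (Fin k)}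
    (h : Served V K S B) (hSF : Disjoint S F) (hF : Served V K F Dᶜ) :
    Served V K (S ∪ F) (B \ D) := by
  obtain ⟨rep, h1, h2⟩ := h
  obtain ⟨rep', h1', h2'⟩ := hF
  refine ⟨fun e => if e ∈ S then rep e else rep' e, fun e i => ?_, fun i hi => ?_⟩
  · dsimp only
    split_ifs
    · exact h1 e i
    · exact h1' e i
  · by_cases hD : i ∈ D
    · refine (h2' i (by simpa using hD)).trans (Finset.card_le_card fun e he => ?_)
      obtain ⟨he1, he2⟩ := Finset.mem_filter.1 he
      refine Finset.mem_filter.2 ⟨Finset.mem_union_right _ he1, ?_⟩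
      simpa [Finset.disjoint_right.1 hSF he1] using he2
    · refine (h2 i fun hB => hi (Finset.mem_sdiff.2 ⟨hB, hD⟩)).trans
        (Finset.card_le_card fun e he => ?_)
      obtain ⟨he1, he2⟩ := Finset.mem_filter.1 he
      refine Finset.mem_filter.2 ⟨Finset.mem_union_left _ he1, ?_⟩
      simpa [he1] using he2

/-- If every component of `D` returns hyperedges sufficiently often, and no hyperedge is returned
too often, then the returned hyperedges represent all components of `D`. -/
theorem Served.of_card_le {τ : Type*} [Fintype τ] (D : Finset (Fin k))
    (G : Fin k → Finset τ) (g : τ → Fin k → Hyperedge n) {K M : ℕ} (hM : 0 < M)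
    (hG : ∀ i ∈ D, K * M ≤ (G i).card)
    (hg : ∀ e, ((D.sigma G).filter fun x => g x.2 x.1 = e).card ≤ M)
    (F : Finset (Hyperedge n)) (hF : ∀ i ∈ D, ∀ t ∈ G i, g t i ∈ F ∧ Touches (g t i) (V i)) :
    Served V K F Dᶜ := by
  classical
  -- Hall's condition for `K` copies of each component, by double counting: the components occurring
  -- in `s` have at least `K M` samples each, and a hyperedge accounts for at most `M` of them.
  have hall : ∀ s : Finset (D × Fin K),
      s.card ≤ (s.biUnion fun x => (G x.1).image fun t => g t x.1).card := by
    intro s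
    set R : Finset (Fin k) := s.image fun x => (x.1 : Fin k)
    have hR : R ⊆ D := by
      intro i hi
      obtain ⟨x, -, rfl⟩ := Finset.mem_image.1 hi
      exact x.1.2
    have h1 : s.card ≤ K * R.card := by
      refine Finset.card_le_mul_card_image s K fun i hi => ?_
      refine (Finset.card_le_card_of_injOn (fun x => x.2) (t := Finset.univ)
        (fun _ _ => Finset.mem_univ _) ?_).trans (by simp)
      intro x hx y hy hxy
      have hx2 := (Finset.mem_filter.1 hx).2
      have hy2 := (Finset.mem_filter.1 hy).2
      exact Prod.ext (Subtype.ext (hx2.trans hy2.symm)) hxy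
    have h2 : (K * M) * R.card ≤ (R.sigma G).card := by
      rw [Finset.card_sigma, mul_comm, ← smul_eq_mul]
      exact Finset.card_nsmul_le_sum _ _ _ fun i hi => hG i (hR hi)
    have h3 : (R.sigma G).card ≤
        M * (s.biUnion fun x => (G x.1).image fun t => g t x.1).card := by
      refine Finset.card_le_mul_card_image_of_maps_to (f := fun x => g x.2 x.1) ?_ M ?_
      · intro x hx
        obtain ⟨hx1, hx2⟩ := Finset.mem_sigma.1 hx
        obtain ⟨y, hy, hyx⟩ := Finset.mem_image.1 hx1
        refine Finset.mem_biUnion.2 ⟨y, hy, ?_⟩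
        rw [hyx]
        exact Finset.mem_image_of_mem (fun t => g t x.1) hx2
      · intro e _
        refine (Finset.card_le_card ?_).trans (hg e)
        exact Finset.filter_subset_filter _ (Finset.sigma_mono hR fun _ => subset_rfl)
    have h4 : M * s.card ≤ M * (s.biUnion fun x => (G x.1).image fun t => g t x.1).card := by
      calc M * s.card ≤ M * (K * R.card) := Nat.mul_le_mul_left _ h1
        _ = (K * M) * R.card := by ring
        _ ≤ _ := h2.trans h3
    exact Nat.le_of_mul_le_mul_left h4 hM
  obtain ⟨f, hinj, hf⟩ := (Finset.all_card_le_biUnion_card_iff_exists_injective _).1 hall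
  refine ⟨fun e => if h : ∃ x, f x = e then some (h.choose.1 : Fin k) else none,
    fun e i hei => ?_, fun i hi => ?_⟩
  · dsimp only at hei
    split_ifs at hei with h
    obtain ⟨t, ht, hte⟩ := Finset.mem_image.1 (hf h.choose)
    have h5 := (hF _ h.choose.1.2 t ht).2
    rw [hte, h.choose_spec, Option.some_injective _ hei] at h5
    exact h5
  · have hiD : i ∈ D := by simpa using hi
    have h6 := Finset.card_le_card_of_injOn (s := (Finset.univ : Finset (Fin K)))
      (fun l => f (⟨i, hiD⟩, l)) (t := F.filter fun e =>
        (if h : ∃ x, f x = e then some (h.choose.1 : Fin k) else none) = some i)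
      ?_ (fun l _ l' _ h => (Prod.ext_iff.1 (hinj h)).2)
    · simpa using h6
    · intro l _
      obtain ⟨t, ht, hte⟩ := Finset.mem_image.1 (hf (⟨i, hiD⟩, l))
      refine Finset.mem_coe.2 (Finset.mem_filter.2 ⟨?_, ?_⟩)
      · exact (congrArg (· ∈ F) hte).mp (hF i hiD t ht).1
      · have h7 : ∃ x, f x = f (⟨i, hiD⟩, l) := ⟨_, rfl⟩
        rw [dif_pos h7, hinj h7.choose_spec]

theorem card_le_of_pairwise_disjoint (hV : Pairwise (Function.onFun Disjoint V))
    (D : Finset (Fin k)) (hD : ∀ i ∈ D, (V i).Nonempty) : D.card ≤ n := by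
  calc D.card = ∑ i ∈ D, 1 := by simp
    _ ≤ ∑ i ∈ D, (V i).card := Finset.sum_le_sum fun i hi => Finset.card_pos.2 (hD i hi)
    _ = (D.biUnion V).card := (Finset.card_biUnion fun i _ j _ hij => hV hij).symm
    _ ≤ n := by simpa using Finset.card_le_univ (D.biUnion V)

end Representatives

/-! ### One round: the invariant and its failure probability -/

section Round

variable {n m : ℕ} {δ : ℝ} {Seed : Type*} [MeasurableSpace Seed] {Sk : Type*} [AddCommGroup Sk]
  (A : L0Sampler (Hyperedge n) Seed Sk n m δ) {H S : Finset (Hyperedge n)} {k : ℕ}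
  {V : Fin k → Finset (Fin n)}

open Classical in
/-- The hyperedges returned in the layers of one round. -/
def returned {τ : Type*} (H S : Finset (Hyperedge n)) (V : Fin k → Finset (Fin n))
    (ω : τ → Coins n × Seed) : Finset (Hyperedge n) :=
  Finset.univ.filter fun e => ∃ t i, opened A H S (V i) (ω t) = some e

/-- The state before a round at rate `p`: the components outside `B` are served, and the
fingerprint of a hyperedge not yet found hits few components of `B`. -/
def BeforeRound (H : Finset (Hyperedge n)) (V : Fin k → Finset (Fin n)) (K : ℕ) (p : ℝ)
    (S : Finset (Hyperedge n)) : Prop :=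
  S ⊆ H ∧ ∃ B : Finset (Fin k), Served V K S B ∧
    ∀ e ∈ H \ S, ∑ j ∈ B, hitProb p (e ∩ V j).card ≤ 12

/-- The state after a round at rate `p`: the components outside `B` are served, and the
fingerprint of a hyperedge not yet found is unlikely to touch a component of `B`. -/
def AfterRound (H : Finset (Hyperedge n)) (V : Fin k → Finset (Fin n)) (K : ℕ) (p : unitInterval)
    (S : Finset (Hyperedge n)) : Prop :=
  S ⊆ H ∧ ∃ B : Finset (Fin k), Served V K S B ∧
    ∀ e ∈ H \ S, (edgeLaw n p).real {ζ | ∃ i ∈ B, Touches (keptPart ζ e) (V i)} < 1 / 2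

/-- By contraposition of `half_le_edgeLaw_exists_touches`, at most 6 components are hit in
expectation; doubling the rate at most doubles this. -/
theorem AfterRound.beforeRound (hV : Pairwise (Function.onFun Disjoint V)) {K : ℕ}
    {p : unitInterval} (h : AfterRound H V K p S) (hp : 2 * (p : ℝ) ≤ 1) :
    BeforeRound H V K (2 * p) S := by
  obtain ⟨hS, B, hB, h2⟩ := h
  refine ⟨hS, B, hB, fun e he => ?_⟩
  have h3 : ∑ j ∈ B, hitProb p (e ∩ V j).card < 6 := by
    by_contra h4
    exact (half_le_edgeLaw_exists_touches hV p e B (not_lt.1 h4)).not_gt (h2 e he)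
  calc _ ≤ ∑ j ∈ B, 2 * hitProb p (e ∩ V j).card :=
        Finset.sum_le_sum fun j _ => hitProb_two_mul_le p.2.1 hp _
    _ ≤ 12 := by rw [← Finset.mul_sum]; linarith

/-- At rate at most `1/n` a fingerprint keeps at most one vertex in expectation, so the invariant
holds with no component served. -/
theorem beforeRound_empty (hV : Pairwise (Function.onFun Disjoint V)) (K : ℕ) {p : unitInterval}
    (hp : n * (p : ℝ) ≤ 1) : BeforeRound H V K p ∅ := by
  refine ⟨Finset.empty_subset _, Finset.univ, ⟨fun _ => none, by simp, by simp⟩, fun e _ => ?_⟩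
  have h1 : ∑ j, (e ∩ V j).card ≤ n := by
    rw [← Finset.card_biUnion fun i _ j _ hij =>
      (hV hij).mono Finset.inter_subset_right Finset.inter_subset_right]
    simpa using Finset.card_le_univ (Finset.univ.biUnion fun j => e ∩ V j)
  have h2 : ((∑ j, (e ∩ V j).card : ℕ) : ℝ) * p ≤ n * p :=
    mul_le_mul_of_nonneg_right (by exact_mod_cast h1) p.2.1
  calc _ ≤ ∑ j, ((e ∩ V j).card : ℝ) * p := Finset.sum_le_sum fun j _ => hitProb_le_mul p _
    _ ≤ 12 := by rw [← Finset.sum_mul]; push_cast at h2; linarith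

/-- At rate `1` a touching probability is `0` or `1`, so being below `1/2` excludes touching
altogether. -/
theorem AfterRound.served_or_complete {K : ℕ} (h : AfterRound H V K 1 S) :
    S ⊆ H ∧ ∃ B : Finset (Fin k), Served V K S B ∧
      ∀ e ∈ H, ∀ i ∈ B, Touches e (V i) → e ∈ S := by
  obtain ⟨hS, B, hB, h2⟩ := h
  refine ⟨hS, B, hB, fun e he i hi ht => ?_⟩
  by_contra hes
  have h3 := h2 e (Finset.mem_sdiff.2 ⟨he, hes⟩)
  have h4 : touchProb (1 : unitInterval) e (V i) ≤
      (edgeLaw n 1).real {ζ | ∃ i ∈ B, Touches (keptPart ζ e) (V i)} := by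
    rw [← edgeLaw_touches]
    exact measureReal_mono fun ζ hζ => ⟨i, hi, hζ⟩
  rw [touchProb, Set.Icc.coe_one, hitProb_one (Finset.card_pos.2 ht.1).ne',
    hitProb_one (Finset.card_pos.2 ht.2).ne'] at h4
  linarith

theorem expectedDegree_empty (H' : Finset (Hyperedge n)) (p : ℝ) : expectedDegree H' p ∅ = 0 := by
  simp [expectedDegree, touchProb, hitProb_zero]

/-- Only few hyperedges are likely to touch components of small expected degree. -/
theorem card_likely_le (hV : Pairwise (Function.onFun Disjoint V)) (p : unitInterval)
    (H' : Finset (Hyperedge n)) (D : Finset (Fin k)) {B : ℝ} (hB0 : 0 ≤ B)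
    (hB : ∀ i ∈ D, expectedDegree H' p (V i) ≤ B) (E : Finset (Hyperedge n)) (hE : E ⊆ H')
    (h : ∀ e ∈ E, 1 / 2 ≤ (edgeLaw n p).real {ζ | ∃ i ∈ D, Touches (keptPart ζ e) (V i)}) :
    (E.card : ℝ) ≤ 2 * (n * B) := by
  classical
  have h1 : ∀ e, (edgeLaw n p).real {ζ | ∃ i ∈ D, Touches (keptPart ζ e) (V i)} ≤
      ∑ i ∈ D, touchProb p e (V i) := by
    intro e
    simp_rw [← edgeLaw_touches]
    refine (measureReal_mono (fun ζ hζ => ?_) (measure_ne_top _ _)).trans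
      (measureReal_biUnion_finset_le _ _)
    obtain ⟨i, hi, h⟩ := hζ
    exact Set.mem_biUnion hi h
  have h2 : (E.card : ℝ) * (1 / 2) ≤ ∑ e ∈ E, ∑ i ∈ D, touchProb p e (V i) := by
    rw [← nsmul_eq_mul]
    exact Finset.card_nsmul_le_sum _ _ _ fun e he => (h e he).trans (h1 e)
  have h3 : ∑ e ∈ E, ∑ i ∈ D, touchProb p e (V i) ≤ ∑ i ∈ D, expectedDegree H' p (V i) := by
    rw [Finset.sum_comm]
    exact Finset.sum_le_sum fun i _ =>
      Finset.sum_le_sum_of_subset_of_nonneg hE fun e _ _ => touchProb_nonneg p e (V i)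
  -- The number `k` of components is not bounded by `n`, but empty ones contribute nothing and at
  -- most `n` disjoint ones are nonempty.
  have h4 : ∑ i ∈ D, expectedDegree H' p (V i) ≤ n * B := by
    have h5 : ∑ i ∈ D.filter (fun i => (V i).Nonempty), expectedDegree H' p (V i) =
        ∑ i ∈ D, expectedDegree H' p (V i) := by
      refine Finset.sum_filter_of_ne fun i _ hne => ?_
      by_contra h6
      exact hne (by rw [Finset.not_nonempty_iff_eq_empty.1 h6, expectedDegree_empty])
    rw [← h5]
    refine (Finset.sum_le_card_nsmul _ _ B fun i hi => hB i (Finset.mem_filter.1 hi).1).trans ?_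
    rw [nsmul_eq_mul]
    refine mul_le_mul_of_nonneg_right ?_ hB0
    exact_mod_cast card_le_of_pairwise_disjoint hV _ fun i hi => (Finset.mem_filter.1 hi).2
  linarith

theorem pi_eval_null {τ Ω : Type*} [Fintype τ] [MeasurableSpace Ω] (ν : Measure Ω)
    [IsProbabilityMeasure ν] {Z : Set Ω} (hZ : ν Z = 0) (t : τ) :
    (Measure.pi fun _ : τ => ν) {ω | ω t ∈ Z} = 0 := by
  rw [← hZ]
  exact (measurePreserving_eval (fun _ : τ => ν) t).measure_preimage (NullMeasurableSet.of_null hZ)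

/-- Almost surely, only hyperedges whose fingerprint touches the component are returned. -/
theorem pi_layerLaw_invalid (hS : S ⊆ H) (hm : H.card ≤ m) (p : unitInterval)
    (V : Fin k → Finset (Fin n)) (τ : Type*) [Fintype τ] :
    (Measure.pi fun _ : τ => layerLaw A p)
      {ω | ∃ t i e, opened A H S (V i) (ω t) = some e ∧ e ∉ touching (H \ S) (ω t).1 (V i)} = 0 := by
  have : {ω : τ → Coins n × Seed | ∃ t i e, opened A H S (V i) (ω t) = some e ∧
      e ∉ touching (H \ S) (ω t).1 (V i)} = ⋃ t, ⋃ i, ⋃ e, {ω | ω t ∈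
        {x | opened A H S (V i) x = some e ∧ e ∉ touching (H \ S) x.1 (V i)}} := by
    ext ω; simp
  rw [this]
  refine measure_iUnion_null fun t => measure_iUnion_null fun i => measure_iUnion_null fun e => ?_
  exact pi_eval_null _ (layerLaw_opened_invalid A hS hm p (V i) e) t

/-- The event that the component `V i` receives a hyperedge whose fingerprint touches few
components of `B`. -/
def goodLayer (H S : Finset (Hyperedge n)) (V : Fin k → Finset (Fin n)) (B : Finset (Fin k))
    (i : Fin k) : Set (Coins n × Seed) :=
  {ω | ∃ e, touchCount V B (keptPart (ω.1 e) e) ≤ 140 ∧ opened A H S (V i) ω = some e}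

theorem measurableSet_goodLayer (H S : Finset (Hyperedge n)) (V : Fin k → Finset (Fin n))
    (B : Finset (Fin k)) (i : Fin k) : MeasurableSet (goodLayer A H S V B i) := by
  have : goodLayer A H S V B i = ⋃ e, {ω | touchCount V B (keptPart (ω.1 e) e) ≤ 140} ∩
      {ω | opened A H S (V i) ω = some e} := by
    ext ω; simp [goodLayer]
  rw [this]
  exact MeasurableSet.iUnion fun e =>
    (measurableSet_coins fun F => touchCount V B (keptPart (F e) e) ≤ 140).inter
      (measurableSet_opened A H S (V i) e)

theorem measurableSet_exists_opened (H S : Finset (Hyperedge n)) (V : Fin k → Finset (Fin n))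
    (D : Finset (Fin k)) (e : Hyperedge n) :
    MeasurableSet {ω | ∃ i ∈ D, opened A H S (V i) ω = some e} := by
  have : {ω | ∃ i ∈ D, opened A H S (V i) ω = some e} =
      ⋃ i ∈ D, {ω | opened A H S (V i) ω = some e} := by
    ext ω; simp
  rw [this]
  exact Finset.measurableSet_biUnion _ fun i _ => measurableSet_opened A H S (V i) e

open Classical in
/-- What has to hold in a round for it to succeed. -/
theorem afterRound_union_returned {τ : Type*} [Fintype τ] {K s : ℕ} (hs : 0 < s)
    {p : unitInterval} {B D : Finset (Fin k)} (hS : S ⊆ H) (hB : Served V K S B) (hD : D ⊆ B)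
    {ω : τ → Coins n × Seed}
    (hvalid : ∀ t i e, opened A H S (V i) (ω t) = some e → e ∈ touching (H \ S) (ω t).1 (V i))
    (hgood : ∀ i ∈ D, K * (140 * s) ≤
      hitCount (goodLayer A H S V B i) ω)
    (hrare : ∀ i ∈ D, ∀ t, ∀ e ∈ H \ S, opened A H S (V i) (ω t) = some e →
      hitCount {x | ∃ j ∈ D, opened A H S (V j) x = some e} ω < s)
    (hfind : ∀ e ∈ H \ S,
      1 / 2 ≤ (edgeLaw n p).real {ζ | ∃ i ∈ B \ D, Touches (keptPart ζ e) (V i)} →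
        ∃ t i, opened A H S (V i) (ω t) = some e) :
    AfterRound H V K p (S ∪ returned A H S V ω) := by
  have hret : ∀ e, e ∈ returned A H S V ω ↔ ∃ t i, opened A H S (V i) (ω t) = some e := by
    intro e; simp [returned]
  have hsub : returned A H S V ω ⊆ H \ S := by
    intro e he
    obtain ⟨t, i, h⟩ := (hret e).1 he
    exact (mem_touching.1 (hvalid t i e h)).1
  refine ⟨Finset.union_subset hS (hsub.trans Finset.sdiff_subset), B \ D, ?_, ?_⟩
  · refine hB.union (Finset.disjoint_right.2 fun e he => (Finset.mem_sdiff.1 (hsub he)).2) ?_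
    -- The default `∅` in `getD` is never used: in a good layer the sampler does return a hyperedge.
    have hmem : ∀ i t, t ∈ (Finset.univ.filter fun t => ω t ∈ goodLayer A H S V B i) →
        opened A H S (V i) (ω t) = some ((opened A H S (V i) (ω t)).getD ∅) ∧
        touchCount V B (keptPart ((ω t).1 ((opened A H S (V i) (ω t)).getD ∅))
          ((opened A H S (V i) (ω t)).getD ∅)) ≤ 140 := by
      intro i t ht
      obtain ⟨e, h1, h2⟩ := (Finset.mem_filter.1 ht).2
      rw [h2]
      exact ⟨rfl, h1⟩
    refine Served.of_card_le D (fun i => Finset.univ.filter fun t => ω t ∈ goodLayer A H S V B i)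
      (fun t i => (opened A H S (V i) (ω t)).getD ∅) (M := 140 * s) (by omega) hgood ?_ _ ?_
    · intro e
      set P := (D.sigma fun i => Finset.univ.filter fun t => ω t ∈ goodLayer A H S V B i).filter
        fun x => (opened A H S (V x.1) (ω x.2)).getD ∅ = e with hP
      have hPm : ∀ x ∈ P, x.1 ∈ D ∧ opened A H S (V x.1) (ω x.2) = some e ∧
          touchCount V B (keptPart ((ω x.2).1 e) e) ≤ 140 := by
        intro x hx
        obtain ⟨h1, h2⟩ := Finset.mem_filter.1 hx
        obtain ⟨h3, h4⟩ := Finset.mem_sigma.1 h1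
        have h5 := hmem x.1 x.2 h4
        rw [h2] at h5
        exact ⟨h3, h5⟩
      rcases P.eq_empty_or_nonempty with h0 | ⟨x, hx⟩
      · rw [h0]; simp
      have hx' := hPm x hx
      have hcount := hrare x.1 hx'.1 x.2 e (mem_touching.1 (hvalid _ _ _ hx'.2.1)).1 hx'.2.1
      -- The multiplicity of `e` is bounded layer by layer: fewer than `s` layers return it to `D`,
      -- and in a good layer it can go only to the at most 140 components its fingerprint touches.
      refine (Finset.card_le_mul_card_image_of_maps_to (f := fun y => y.2)
        (t := Finset.univ.filter fun u =>
          ω u ∈ {x | ∃ j ∈ D, opened A H S (V j) x = some e}) ?_ 140 ?_).trans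
        (Nat.mul_le_mul_left _ ((card_le_hitCount fun u hu => (Finset.mem_filter.1 hu).2).trans
          hcount.le))
      · intro y hy
        exact Finset.mem_filter.2 ⟨Finset.mem_univ _, y.1, (hPm y hy).1, (hPm y hy).2.1⟩
      · intro u _
        rcases (P.filter fun y => y.2 = u).eq_empty_or_nonempty with h0 | ⟨y, hy⟩
        · rw [h0]; simp
        obtain ⟨hy1, hy2⟩ := Finset.mem_filter.1 hy
        have hy3 := (hPm y hy1).2.2
        rw [hy2] at hy3
        refine le_trans (Finset.card_le_card_of_injOn (fun z => z.1) ?_ ?_) hy3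
        · intro z hz
          obtain ⟨hz1, hz2⟩ := Finset.mem_filter.1 hz
          have hz3 := hPm z hz1
          have hz4 := (mem_touching.1 (hvalid _ _ _ hz3.2.1)).2
          rw [hz2] at hz4
          exact Finset.mem_coe.2 (Finset.mem_filter.2 ⟨hD hz3.1, hz4⟩)
        · intro z hz w hw hzw
          have hz2 := (Finset.mem_filter.1 hz).2
          have hw2 := (Finset.mem_filter.1 hw).2
          exact Sigma.ext hzw (heq_of_eq (hz2.trans hw2.symm))
    · intro i _ t ht
      have h1 := (hmem i t ht).1
      refine ⟨(hret _).2 ⟨t, i, h1⟩, ?_⟩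
      have h2 := (mem_touching.1 (hvalid t i _ h1)).2
      exact ⟨h2.1.mono (Finset.inter_subset_inter_right (Finset.filter_subset _ _)),
        h2.2.mono (Finset.sdiff_subset_sdiff (Finset.filter_subset _ _) subset_rfl)⟩
  · intro e he
    by_contra h
    have he' : e ∈ H \ S := by
      simp only [Finset.mem_sdiff, Finset.mem_union, not_or] at he ⊢
      exact ⟨he.1, he.2.1⟩
    have := (hret e).2 (hfind e he' (not_lt.1 h))
    exact (Finset.mem_sdiff.1 he).2 (Finset.mem_union_right _ this)

/-- The bound on the failure probability of a round of `T` layers. -/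
def roundError (n r s T : ℕ) : ℝ :=
  n * (T * ((1 / 2) ^ s * (2 * (1 + 24 / (r : ℝ)) ^ T))) + n * (2 ^ r * (7 / 8) ^ T) +
    2 * (n * r) * (2 * (1 - 1 / (8 * (1 + (r : ℝ)))) ^ T)

/-- The failure modes are `N0`, an invalid sample (a null event); `N1`, a hyperedge returned to `D`
too often; `N2`, too few good samples for a component of `D`; and `N3`, a likely hyperedge never
returned. The last three give the three terms of `roundError`. -/
theorem pi_layerLaw_not_afterRound_le {τ : Type*} [Fintype τ] (hδ : δ ≤ 1 / 2)
    (hm : H.card ≤ m) (hV : Pairwise (Function.onFun Disjoint V)) {K s : ℕ} (hK : 0 < K)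
    (hs : 0 < s) {p : unitInterval} (h : BeforeRound H V K p S) :
    (Measure.pi fun _ : τ => layerLaw A p).real
        {ω | ¬ AfterRound H V K p (S ∪ returned A H S V ω)} ≤
      roundError n (K * (140 * s)) s (Fintype.card τ) := by
  classical
  obtain ⟨hS, B, hB, hhit⟩ := h
  set r := K * (140 * s) with hr
  have hr4 : 4 ≤ r := by
    have : 1 ≤ K * s := Nat.mul_pos hK hs
    rw [hr]; nlinarith
  have hr4' : (4 : ℝ) ≤ r := by exact_mod_cast hr4
  set ν := layerLaw A p with hν
  -- The same `r` serves as degree threshold and as the number of good samples required.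
  set D := B.filter fun i => (r : ℝ) < expectedDegree (H \ S) p (V i) with hDdef
  have hD : ∀ i ∈ D, (r : ℝ) < expectedDegree (H \ S) p (V i) := fun i hi =>
    (Finset.mem_filter.1 hi).2
  have hDB : D ⊆ B := Finset.filter_subset _ _
  have hBD : ∀ i ∈ B \ D, expectedDegree (H \ S) p (V i) ≤ r := by
    intro i hi
    rw [Finset.mem_sdiff] at hi
    by_contra h
    exact hi.2 (Finset.mem_filter.2 ⟨hi.1, not_le.1 h⟩)
  have hDn : (D.card : ℝ) ≤ n := by
    have : D.card ≤ n := card_le_of_pairwise_disjoint hV D fun i hi => by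
      by_contra h0
      have := hD i hi
      rw [Finset.not_nonempty_iff_eq_empty.1 h0, expectedDegree_empty] at this
      linarith
    exact_mod_cast this
  set E : Hyperedge n → Set (Coins n × Seed) := fun e =>
    {x | ∃ j ∈ D, opened A H S (V j) x = some e} with hE
  have hEm : ∀ e, MeasurableSet (E e) := fun e => measurableSet_exists_opened A H S V D e
  set X : Fin k → Hyperedge n → Set (Coins n × Seed) := fun i e =>
    {x | opened A H S (V i) x = some e} with hX
  set L := (H \ S).filter fun e =>
    1 / 2 ≤ (edgeLaw n p).real {ζ | ∃ i ∈ B \ D, Touches (keptPart ζ e) (V i)} with hL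
  set N0 : Set (τ → Coins n × Seed) := {ω | ∃ t i e, opened A H S (V i) (ω t) = some e ∧
    e ∉ touching (H \ S) (ω t).1 (V i)} with hN0
  set N1 : Set (τ → Coins n × Seed) := ⋃ i ∈ D, ⋃ t ∈ (Finset.univ : Finset τ), ⋃ e ∈ H \ S,
    {ω | ω t ∈ X i e ∧ s ≤ hitCount (E e) ω} with hN1
  set N2 : Set (τ → Coins n × Seed) := ⋃ i ∈ D,
    {ω | hitCount (goodLayer A H S V B i) ω < r} with hN2
  set N3 : Set (τ → Coins n × Seed) := ⋃ e ∈ L, 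
    {ω | hitCount {x | ∃ i ∈ B \ D, opened A H S (V i) x = some e} ω < 1} with hN3
  have hsub : {ω | ¬ AfterRound H V K p (S ∪ returned A H S V ω)} ⊆ N0 ∪ (N1 ∪ N2 ∪ N3) := by
    intro ω hω
    by_contra hnot
    simp only [Set.mem_union, not_or] at hnot
    obtain ⟨h0, ⟨h1, h2⟩, h3⟩ := hnot
    refine hω (afterRound_union_returned A hs hS hB hDB ?_ ?_ ?_ ?_)
    · intro t i e hte
      by_contra h
      exact h0 ⟨t, i, e, hte, h⟩
    · intro i hi
      by_contra h
      exact h2 (Set.mem_biUnion (Finset.mem_coe.2 hi) (not_le.1 h))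
    · intro i hi t e he hte
      by_contra h
      exact h1 (Set.mem_biUnion (Finset.mem_coe.2 hi) (Set.mem_biUnion (Finset.mem_univ t)
        (Set.mem_biUnion (Finset.mem_coe.2 he) ⟨hte, not_lt.1 h⟩)))
    · intro e he hle
      by_contra h
      refine h3 (Set.mem_biUnion (Finset.mem_coe.2 (Finset.mem_filter.2 ⟨he, hle⟩)) ?_)
      refine hitCount_lt_one_iff.2 ?_
      rintro t ⟨i, -, hi⟩
      exact h ⟨t, i, hi⟩
  have hb0 : (Measure.pi fun _ : τ => ν).real N0 = 0 := by
    rw [measureReal_def, pi_layerLaw_invalid A hS hm p V τ, ENNReal.toReal_zero]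
  have hb1 : (Measure.pi fun _ : τ => ν).real N1 ≤
      n * (Fintype.card τ * ((1 / 2) ^ s * (2 * (1 + 24 / (r : ℝ)) ^ Fintype.card τ))) := by
    refine measureReal_biUnion_le_mul _ D _ ?_ hDn fun i hi => ?_
    · positivity
    · refine measureReal_biUnion_le_mul _ _ _ ?_ (by rw [Finset.card_univ]) fun t _ => ?_
      · positivity
      refine (measureReal_biUnion_finset_le _ _).trans ?_
      -- A sampler returns at most one hyperedge, so these events are disjoint. The union bound over
      -- hyperedges therefore costs a factor `1` instead of `|H|`.
      have hXs : ∑ e ∈ H \ S, ν.real (X i e) ≤ 1 := by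
        rw [← measureReal_biUnion_finset]
        · exact measureReal_le_one
        · intro e _ e' _ hne
          refine Set.disjoint_left.2 fun x h1 h2 => hne ?_
          exact Option.some_injective _ (h1.symm.trans h2)
        · exact fun e _ => measurableSet_opened A H S (V i) e
      have hstep : ∀ e ∈ H \ S, (Measure.pi fun _ : τ => ν).real
          {ω | ω t ∈ X i e ∧ s ≤ hitCount (E e) ω} ≤
            ν.real (X i e) * ((1 / 2) ^ s * (2 * (1 + 24 / (r : ℝ)) ^ Fintype.card τ)) := by
        intro e he
        refine (measureReal_mem_and_le_hitCount_le ν (measurableSet_opened A H S (V i) e) (hEm e)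
          (fun x hx => ⟨i, hi, hx⟩) t s).trans ?_
        have hEe : ν.real (E e) ≤ 24 / r := by
          refine layerLaw_exists_opened_le A hS hm p D (by linarith) hD he
            ((Finset.sum_le_sum_of_subset_of_nonneg hDB fun j _ _ => hitProb_nonneg _ _).trans
              (hhit e he))
        have hpow : (1 + ν.real (E e)) ^ Fintype.card τ ≤
            (1 + 24 / (r : ℝ)) ^ Fintype.card τ :=
          pow_le_pow_left₀ (by positivity) (by linarith) _
        calc _ ≤ (1 / 2) ^ s * (2 * ν.real (X i e) * (1 + 24 / (r : ℝ)) ^ Fintype.card τ) := by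
              refine mul_le_mul_of_nonneg_left (mul_le_mul_of_nonneg_left hpow ?_) ?_ <;> positivity
          _ = _ := by ring
      refine (Finset.sum_le_sum hstep).trans ?_
      rw [← Finset.sum_mul]
      exact mul_le_of_le_one_left (by positivity) hXs
  have hb2 : (Measure.pi fun _ : τ => ν).real N2 ≤ n * (2 ^ r * (7 / 8) ^ Fintype.card τ) := by
    refine measureReal_biUnion_le_mul _ D _ ?_ hDn fun i hi => ?_
    · positivity
    · refine (measureReal_hitCount_lt_le ν (measurableSet_goodLayer A H S V B i) r).trans ?_
      have h1 : 1 / 4 ≤ ν.real (goodLayer A H S V B i) :=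
        quarter_le_layerLaw_good A hδ hS hm hV p B hhit (hDB hi) (hr4'.trans (hD i hi).le)
      have h2 : ν.real (goodLayer A H S V B i) ≤ 1 := measureReal_le_one
      refine mul_le_mul_of_nonneg_left (pow_le_pow_left₀ ?_ ?_ _) (by positivity) <;> linarith
  have hfrac : 0 ≤ 1 - 1 / (8 * (1 + (r : ℝ))) := by
    rw [sub_nonneg, div_le_one (by positivity)]; linarith
  have hb3 : (Measure.pi fun _ : τ => ν).real N3 ≤
      2 * (n * r) * (2 * (1 - 1 / (8 * (1 + (r : ℝ)))) ^ Fintype.card τ) := by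
    have hLc : (L.card : ℝ) ≤ 2 * (n * r) :=
      card_likely_le hV p (H \ S) (B \ D) (by positivity) hBD L (Finset.filter_subset _ _)
        fun e he => (Finset.mem_filter.1 he).2
    refine measureReal_biUnion_le_mul _ L _ ?_ hLc fun e he => ?_
    · positivity
    · obtain ⟨he1, he2⟩ := Finset.mem_filter.1 he
      refine (measureReal_hitCount_lt_le ν (measurableSet_exists_opened A H S V (B \ D) e) 1).trans ?_
      have h1 := le_layerLaw_exists_opened A hδ hS hm p (B \ D) (by positivity) hBD he1
      have h2 : 1 / (4 * (1 + (r : ℝ))) ≤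
          ν.real {ω | ∃ i ∈ B \ D, opened A H S (V i) ω = some e} := by
        refine le_trans ?_ h1
        calc 1 / (4 * (1 + (r : ℝ))) = 1 / 2 / (2 * (1 + (r : ℝ))) := by field_simp; norm_num
          _ ≤ _ := div_le_div_of_nonneg_right he2 (by positivity)
      have h3 : 1 / (8 * (1 + (r : ℝ))) = 1 / (4 * (1 + (r : ℝ))) / 2 := by field_simp; norm_num
      have h4 : ν.real {ω | ∃ i ∈ B \ D, opened A H S (V i) ω = some e} ≤ 1 := measureReal_le_one
      rw [pow_one]
      refine mul_le_mul_of_nonneg_left (pow_le_pow_left₀ ?_ ?_ _) (by norm_num) <;> linarith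
  have h1 := measureReal_mono (μ := Measure.pi fun _ : τ => ν) hsub
  have h2 := measureReal_union_le (μ := Measure.pi fun _ : τ => ν) N0 (N1 ∪ N2 ∪ N3)
  have h3 := measureReal_union_le (μ := Measure.pi fun _ : τ => ν) (N1 ∪ N2) N3
  have h4 := measureReal_union_le (μ := Measure.pi fun _ : τ => ν) N1 N2
  rw [roundError]
  linarith

/-- The samplers of the layers at rate `1` detect every component that is not complete. -/
theorem pi_layerLaw_undetected_le {τ : Type*} [Fintype τ] (hδ : δ ≤ 1 / 2) (hm : H.card ≤ m)
    (hV : Pairwise (Function.onFun Disjoint V)) (hS : S ⊆ H) :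
    (Measure.pi fun _ : τ => layerLaw A 1).real
        {ω | ∃ i, (∃ e ∈ H \ S, Touches e (V i)) ∧ ∀ t, opened A H S (V i) (ω t) = none} ≤
      n * (2 * (7 / 8) ^ Fintype.card τ) := by
  classical
  set D := Finset.univ.filter fun i => ∃ e ∈ H \ S, Touches e (V i) with hDdef
  have hDn : (D.card : ℝ) ≤ n := by
    have : D.card ≤ n := card_le_of_pairwise_disjoint hV D fun i hi => by
      obtain ⟨e, -, he⟩ := (Finset.mem_filter.1 hi).2
      exact he.1.mono Finset.inter_subset_right
    exact_mod_cast this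
  have hsub : {ω : τ → Coins n × Seed | ∃ i, (∃ e ∈ H \ S, Touches e (V i)) ∧
      ∀ t, opened A H S (V i) (ω t) = none} ⊆
        ⋃ i ∈ D, 
          {ω | hitCount (⋃ e ∈ H \ S, {x | opened A H S (V i) x = some e}) ω < 1} := by
    rintro ω ⟨i, hi, hnone⟩
    refine Set.mem_biUnion (Finset.mem_coe.2 (Finset.mem_filter.2 ⟨Finset.mem_univ _, hi⟩)) ?_
    refine hitCount_lt_one_iff.2 fun t ht => ?_
    simp only [Set.mem_iUnion, Set.mem_ofPred_eq, hnone t] at ht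
    obtain ⟨_, _, h⟩ := ht
    cases h
  refine (measureReal_mono hsub (measure_ne_top _ _)).trans
    (measureReal_biUnion_le_mul _ D _ (by positivity) hDn fun i hi => ?_)
  · refine (measureReal_hitCount_lt_le _ (Finset.measurableSet_biUnion _ fun e _ =>
      measurableSet_opened A H S (V i) e) 1).trans ?_
    rw [pow_one]
    -- At rate `1` the missing hyperedge surely touches, so the argument yields `1/2`; the weaker
    -- `1/4` gives the same base `7/8` as in `roundError`.
    have h1 : 1 / 4 ≤ (layerLaw A 1).real (⋃ e ∈ H \ S, {x | opened A H S (V i) x = some e}) := by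
      rw [measureReal_biUnion_finset]
      · obtain ⟨e, he, ht⟩ := (Finset.mem_filter.1 hi).2
        have hpart : ∀ e ∈ H \ S, 1 / 2 * (touchProb (1 : unitInterval) e (V i) *
            meanShare ((H \ S).erase e) 1 (V i)) ≤
              (layerLaw A 1).real {x | opened A H S (V i) x = some e} := by
          intro e he
          have := le_layerLaw_opened A hδ hS hm 1 (V i) he Set.univ
          rw [Set.univ_inter, edgeLaw_touches] at this
          simpa using this
        refine le_trans ?_ (Finset.sum_le_sum hpart)
        rw [← Finset.mul_sum, sum_touchProb_mul_meanShare]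
        have h2 : touchProb (1 : unitInterval) e (V i) ≤
            (coinLaw n 1).real {F | (touching (H \ S) F (V i)).Nonempty} := by
          have h3 := integral_pi_mul_of_update_eq (fun _ => edgeLaw n 1) e
            ({ζ | Touches (keptPart ζ e) (V i)}.indicator 1) (fun _ => (1 : ℝ)) fun _ _ => rfl
          rw [integral_indicator_one (.of_discrete), edgeLaw_touches] at h3
          simp only [integral_const, probReal_univ, smul_eq_mul, mul_one] at h3
          rw [← h3, ← coinLaw_eq, ← integral_indicator_one (.of_discrete)]
          refine integral_mono .of_finite .of_finite fun F => ?_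
          by_cases hF : Touches (keptPart (F e) e) (V i)
          · have : (touching (H \ S) F (V i)).Nonempty := ⟨e, mem_touching.2 ⟨he, hF⟩⟩
            simp [hF, this]
          · simp only [Set.indicator_of_notMem (s := {ζ | Touches (keptPart ζ e) (V i)}) hF]
            exact Set.indicator_nonneg (fun _ _ => zero_le_one) _
        rw [touchProb, Set.Icc.coe_one, hitProb_one (Finset.card_pos.2 ht.1).ne',
          hitProb_one (Finset.card_pos.2 ht.2).ne'] at h2
        linarith
      · intro e _ e' _ hne
        refine Set.disjoint_left.2 fun x h1 h2 => hne ?_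
        exact Option.some_injective _ (h1.symm.trans h2)
      · exact fun e _ => measurableSet_opened A H S (V i) e
    have h2 : (layerLaw A 1).real (⋃ e ∈ H \ S, {x | opened A H S (V i) x = some e}) ≤ 1 :=
      measureReal_le_one
    refine mul_le_mul_of_nonneg_left (pow_le_pow_left₀ ?_ ?_ _) (by norm_num) <;> linarith

end Round

/-! ### Adaptively chosen events -/

section Adaptive

/-- If a rare event of the coordinates in `s` is chosen depending on the other coordinates only, it
remains rare. -/
theorem pi_adaptive_le {ι Ω α : Type*} [Fintype ι] [DecidableEq ι] [MeasurableSpace Ω] [Finite α]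
    (μ : ι → Measure Ω) [∀ i, IsProbabilityMeasure (μ i)] (s : Finset ι) (σ : (ι → Ω) → α)
    (hσ : ∀ x y, σ (Function.updateFinset x s y) = σ x)
    (hσm : ∀ a, MeasurableSet {ω | σ ω = a}) (Bad : α → Set (s → Ω))
    (hm : ∀ a, MeasurableSet (Bad a)) {ε : ENNReal}
    (hε : ∀ a, Measure.pi (fun i : s => μ i) (Bad a) ≤ ε) :
    Measure.pi μ {ω | (fun i : s => ω i) ∈ Bad (σ ω)} ≤ ε := by
  have hms : MeasurableSet {ω : ι → Ω | (fun i : s => ω i) ∈ Bad (σ ω)} := by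
    have : {ω : ι → Ω | (fun i : s => ω i) ∈ Bad (σ ω)} =
        ⋃ a, {ω | σ ω = a} ∩ (fun ω : ι → Ω => fun i : s => ω i) ⁻¹' Bad a := by
      ext ω; simp
    rw [this]
    exact MeasurableSet.iUnion fun a => (hσm a).inter ((by fun_prop : Measurable
      (fun ω : ι → Ω => fun i : s => ω i)) (hm a))
  have h := lintegral_le_of_lmarginal_le (μ := μ) s
    (f := {ω : ι → Ω | (fun i : s => ω i) ∈ Bad (σ ω)}.indicator 1) (g := fun _ => ε)
    (measurable_one.indicator hms) measurable_const ?_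
  · rw [lintegral_indicator_one hms] at h
    simpa using h
  · intro x
    rw [lmarginal, lmarginal]
    have : ∀ y : s → Ω, {ω : ι → Ω | (fun i : s => ω i) ∈ Bad (σ ω)}.indicator
        (1 : (ι → Ω) → ENNReal) (Function.updateFinset x s y) = (Bad (σ x)).indicator 1 y := by
      intro y
      have h1 : (fun i : s => Function.updateFinset x s y i) = y := by
        funext i; simp [Function.updateFinset]
      by_cases hy : y ∈ Bad (σ x)
      · rw [Set.indicator_of_mem hy, Set.indicator_of_mem]
        · rfl
        · simp only [Set.mem_ofPred_eq, hσ, h1, hy]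
      · rw [Set.indicator_of_notMem hy, Set.indicator_of_notMem]
        simp only [Set.mem_ofPred_eq, hσ, h1, hy, not_false_eq_true]
    simp_rw [this]
    rw [lintegral_indicator_one (hm _)]
    simpa using hε (σ x)

end Adaptive

/-! ### Composition of the rounds -/

section Rounds

variable {n m : ℕ} {δ : ℝ} {Seed : Type*} [MeasurableSpace Seed] {Sk : Type*} [AddCommGroup Sk]
  (A : L0Sampler (Hyperedge n) Seed Sk n m δ) {k : ℕ} {ι : Type*} [Fintype ι]

theorem measurableSet_returned {τ : Type*} [Fintype τ] (H S : Finset (Hyperedge n))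
    (V : Fin k → Finset (Fin n)) (P : Finset (Hyperedge n) → Prop) :
    MeasurableSet {ω : τ → Coins n × Seed | P (returned A H S V ω)} := by
  have h1 : ∀ e, MeasurableSet {ω : τ → Coins n × Seed | e ∈ returned A H S V ω} := by
    intro e
    have : {ω : τ → Coins n × Seed | e ∈ returned A H S V ω} =
        ⋃ t, ⋃ i, (fun ω : τ → Coins n × Seed => ω t) ⁻¹' {x | opened A H S (V i) x = some e} := by
      ext ω; simp [returned]
    rw [this]
    exact MeasurableSet.iUnion fun t => MeasurableSet.iUnion fun i =>
      measurable_pi_apply t (measurableSet_opened A H S (V i) e)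
  have h2 : ∀ R, MeasurableSet {ω : τ → Coins n × Seed | returned A H S V ω = R} := by
    intro R
    have : {ω : τ → Coins n × Seed | returned A H S V ω = R} =
        ⋂ e, {ω | e ∈ returned A H S V ω ↔ e ∈ R} := by
      ext ω; simp [Finset.ext_iff]
    rw [this]
    refine MeasurableSet.iInter fun e => ?_
    by_cases he : e ∈ R
    · simpa [he] using h1 e
    · have h4 : {ω : τ → Coins n × Seed | e ∈ returned A H S V ω ↔ e ∈ R} =
          {ω | e ∈ returned A H S V ω}ᶜ := by
        ext ω; simp [he]
      rw [h4]
      exact (h1 e).compl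
  have h3 : {ω : τ → Coins n × Seed | P (returned A H S V ω)} =
      ⋃ R, ⋃ (_ : P R), {ω | returned A H S V ω = R} := by
    ext ω; simp
  rw [h3]
  exact MeasurableSet.iUnion fun R => MeasurableSet.iUnion fun _ => h2 R

/-- The layers of round `j`. -/
def layersOf (rd : ι → ℕ) (j : ℕ) : Finset ι := Finset.univ.filter fun t => rd t = j

/-- The hyperedges found before round `j`. -/
def foundSet (rd : ι → ℕ) (H : Finset (Hyperedge n)) (V : Fin k → Finset (Fin n))
    (ω : ι → Coins n × Seed) : ℕ → Finset (Hyperedge n)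
  | 0 => ∅
  | j + 1 => foundSet rd H V ω j ∪
      returned A H (foundSet rd H V ω j) V (fun t : layersOf rd j => ω t)

/-- The layers of a round are fresh: earlier rounds never read them. This is the hypothesis on `σ`
in `pi_adaptive_le`. -/
theorem foundSet_updateFinset [DecidableEq ι] (rd : ι → ℕ) (H : Finset (Hyperedge n))
    (V : Fin k → Finset (Fin n)) (j : ℕ) (x : ι → Coins n × Seed)
    (y : layersOf rd j → Coins n × Seed) {j' : ℕ} (hj : j' ≤ j) :
    foundSet A rd H V (Function.updateFinset x (layersOf rd j) y) j' = foundSet A rd H V x j' := by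
  induction j' with
  | zero => rfl
  | succ j' ih =>
    have h1 : (fun t : layersOf rd j' => Function.updateFinset x (layersOf rd j) y t) =
        fun t : layersOf rd j' => x t := by
      funext t
      have h2 : (t : ι) ∉ layersOf rd j := by
        have := (Finset.mem_filter.1 t.2).2
        simp only [layersOf, Finset.mem_filter, Finset.mem_univ, true_and]
        omega
      simp [Function.updateFinset, h2]
    rw [foundSet, foundSet, ih (by omega), h1]

theorem measurableSet_foundSet (rd : ι → ℕ) (H : Finset (Hyperedge n))
    (V : Fin k → Finset (Fin n)) (j : ℕ) (R : Finset (Hyperedge n)) :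
    MeasurableSet {ω | foundSet A rd H V ω j = R} := by
  induction j generalizing R with
  | zero => exact MeasurableSet.const (∅ = R)
  | succ j ih =>
    have : {ω | foundSet A rd H V ω (j + 1) = R} = ⋃ S, {ω | foundSet A rd H V ω j = S} ∩
        (fun ω : ι → Coins n × Seed => fun t : layersOf rd j => ω t) ⁻¹'
          {y | S ∪ returned A H S V y = R} := by
      ext ω; simp [foundSet]
    rw [this]
    exact MeasurableSet.iUnion fun S => (ih S).inter ((by fun_prop : Measurable
      (fun ω : ι → Coins n × Seed => fun t : layersOf rd j => ω t))
        (measurableSet_returned A H S V fun F => S ∪ F = R))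

/-- The fingerprinting rate of round `j`. -/
def rate (J j : ℕ) : unitInterval :=
  ⟨(1 / 2) ^ (J - j), by positivity, pow_le_one₀ (by norm_num) (by norm_num)⟩

theorem rate_eq_one {J j : ℕ} (h : J ≤ j) : rate J j = 1 := by
  ext; simp [rate, Nat.sub_eq_zero_of_le h]

theorem two_mul_rate {J j : ℕ} (h : j < J) : 2 * (rate J j : ℝ) = rate J (j + 1) := by
  have : J - j = J - (j + 1) + 1 := by omega
  simp only [rate, this, pow_succ]
  ring

/-- The state reached before round `j`. -/
def RoundInvariant (H : Finset (Hyperedge n)) (V : Fin k → Finset (Fin n)) (K J j : ℕ)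
    (S : Finset (Hyperedge n)) : Prop :=
  if j ≤ J then BeforeRound H V K (rate J j) S else AfterRound H V K 1 S

theorem AfterRound.roundInvariant {H : Finset (Hyperedge n)} {V : Fin k → Finset (Fin n)}
    (hV : Pairwise (Function.onFun Disjoint V)) {K J j : ℕ} (hj : j ≤ J)
    {S : Finset (Hyperedge n)} (h : AfterRound H V K (rate J j) S) :
    RoundInvariant H V K J (j + 1) S := by
  rcases hj.lt_or_eq with hlt | rfl
  · rw [RoundInvariant, if_pos (Nat.succ_le_of_lt hlt), ← two_mul_rate hlt]
    refine h.beforeRound hV ?_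
    rw [two_mul_rate hlt]
    exact (rate J (j + 1)).2.2
  · rw [RoundInvariant, if_neg (by omega)]
    rwa [rate_eq_one le_rfl] at h

theorem measure_le_ofReal {α : Type*} [MeasurableSpace α] (μ : Measure α) [IsFiniteMeasure μ]
    {s : Set α} {x : ℝ} (h : μ.real s ≤ x) : μ s ≤ ENNReal.ofReal x := by
  rw [← ofReal_measureReal]
  exact ENNReal.ofReal_le_ofReal h

theorem pi_layersOf (rd : ι → ℕ) (J j : ℕ) :
    (Measure.pi fun t : layersOf rd j => layerLaw A (rate J (rd t))) =
      Measure.pi fun _ : layersOf rd j => layerLaw A (rate J j) := by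
  congr 1
  funext t
  rw [(Finset.mem_filter.1 t.2).2]

theorem pi_not_roundInvariant_succ_le (hδ : δ ≤ 1 / 2) (rd : ι → ℕ)
    {H : Finset (Hyperedge n)} (hm : H.card ≤ m) {V : Fin k → Finset (Fin n)}
    (hV : Pairwise (Function.onFun Disjoint V)) {K s J j : ℕ} (hK : 0 < K) (hs : 0 < s)
    (hj : j ≤ J) :
    (Measure.pi fun t => layerLaw A (rate J (rd t)))
        {ω | RoundInvariant H V K J j (foundSet A rd H V ω j) ∧
          ¬ RoundInvariant H V K J (j + 1) (foundSet A rd H V ω (j + 1))} ≤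
      ENNReal.ofReal (roundError n (K * (140 * s)) s (layersOf rd j).card) := by
  classical
  refine pi_adaptive_le (fun t => layerLaw A (rate J (rd t))) (layersOf rd j)
    (fun ω => foundSet A rd H V ω j) (fun x y => foundSet_updateFinset A rd H V j x y le_rfl)
    (measurableSet_foundSet A rd H V j)
    (fun S => {y | RoundInvariant H V K J j S ∧
      ¬ RoundInvariant H V K J (j + 1) (S ∪ returned A H S V y)})
    (fun S => measurableSet_returned A H S V fun F => RoundInvariant H V K J j S ∧
      ¬ RoundInvariant H V K J (j + 1) (S ∪ F)) fun S => ?_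
  rw [pi_layersOf]
  by_cases hS : RoundInvariant H V K J j S
  · have hS' := hS
    rw [RoundInvariant, if_pos hj] at hS'
    refine (measure_mono ?_).trans (measure_le_ofReal _
      ((pi_layerLaw_not_afterRound_le A (τ := layersOf rd j) hδ hm hV hK hs hS').trans ?_))
    · rintro y ⟨-, hy⟩ hafter
      exact hy (hafter.roundInvariant hV hj)
    · rw [Fintype.card_coe]
  · simp [hS]

theorem measurableSet_opened_none (H S : Finset (Hyperedge n)) (W : Finset (Fin n)) :
    MeasurableSet {ω | opened A H S W ω = none} := by
  have : {ω | opened A H S W ω = none} = (⋃ e, {ω | opened A H S W ω = some e})ᶜ := by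
    ext ω; simp [Option.eq_none_iff_forall_ne_some]
  rw [this]
  exact (MeasurableSet.iUnion fun e => measurableSet_opened A H S W e).compl

theorem pi_undetected_le (hδ : δ ≤ 1 / 2) (rd : ι → ℕ) {H : Finset (Hyperedge n)}
    (hm : H.card ≤ m) {V : Fin k → Finset (Fin n)} (hV : Pairwise (Function.onFun Disjoint V))
    {J j : ℕ} (hj : J ≤ j) :
    (Measure.pi fun t => layerLaw A (rate J (rd t)))
        {ω | foundSet A rd H V ω j ⊆ H ∧
          ∃ i, (∃ e ∈ H \ foundSet A rd H V ω j, Touches e (V i)) ∧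
            ∀ t : layersOf rd j, opened A H (foundSet A rd H V ω j) (V i) (ω t) = none} ≤
      ENNReal.ofReal (n * (2 * (7 / 8) ^ (layersOf rd j).card)) := by
  classical
  refine pi_adaptive_le (fun t => layerLaw A (rate J (rd t))) (layersOf rd j)
    (fun ω => foundSet A rd H V ω j) (fun x y => foundSet_updateFinset A rd H V j x y le_rfl)
    (measurableSet_foundSet A rd H V j)
    (fun S => {y | S ⊆ H ∧ ∃ i, (∃ e ∈ H \ S, Touches e (V i)) ∧
      ∀ t : layersOf rd j, opened A H S (V i) (y t) = none})
    (fun S => ?_) fun S => ?_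
  · have : {y : layersOf rd j → Coins n × Seed | S ⊆ H ∧ ∃ i, (∃ e ∈ H \ S, Touches e (V i)) ∧
        ∀ t : layersOf rd j, opened A H S (V i) (y t) = none} =
          {_y | S ⊆ H} ∩ ⋃ i, {_y | ∃ e ∈ H \ S, Touches e (V i)} ∩
            ⋂ t : layersOf rd j, (fun y : layersOf rd j → Coins n × Seed => y t) ⁻¹'
              {x | opened A H S (V i) x = none} := by
      ext y; simp
    rw [this]
    exact (MeasurableSet.const _).inter (MeasurableSet.iUnion fun i =>
      (MeasurableSet.const _).inter (MeasurableSet.iInter fun t =>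
        measurable_pi_apply t (measurableSet_opened_none A H S (V i))))
  · rw [pi_layersOf, rate_eq_one hj]
    by_cases hS : S ⊆ H
    · simp only [hS, true_and]
      refine measure_le_ofReal _ ((pi_layerLaw_undetected_le A hδ hm hV hS).trans ?_)
      rw [Fintype.card_coe]
    · simp [hS]

/-- The recovery procedure fails with small probability. -/
theorem pi_not_isRecovery_le (hδ : δ ≤ 1 / 2) (rd : ι → ℕ) {H : Finset (Hyperedge n)}
    (hm : H.card ≤ m) {V : Fin k → Finset (Fin n)} (hV : Pairwise (Function.onFun Disjoint V))
    {φ : ℝ} {K s J T : ℕ} (hK : 0 < K) (hs : 0 < s) (hKφ : φ * Real.logb 2 n ≤ K)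
    (hJ : n ≤ 2 ^ J) (hT : ∀ j < J + 2, (layersOf rd j).card = T)
    (complete : (ι → Coins n × Seed) → Fin k → Bool)
    (hc : ∀ ω i, complete ω i = true ↔ ∀ t : layersOf rd (J + 1),
      opened A H (foundSet A rd H V ω (J + 1)) (V i) (ω t) = none) :
    (Measure.pi fun t => layerLaw A (rate J (rd t)))
        {ω | ¬ IsRecovery H φ V (foundSet A rd H V ω (J + 1)) (complete ω)} ≤
      ENNReal.ofReal ((J + 2) * roundError n (K * (140 * s)) s T) := by
  classical
  set μ := Measure.pi fun t => layerLaw A (rate J (rd t)) with hμ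
  set N1 : ℕ → Set (ι → Coins n × Seed) := fun j =>
    {ω | RoundInvariant H V K J j (foundSet A rd H V ω j) ∧
      ¬ RoundInvariant H V K J (j + 1) (foundSet A rd H V ω (j + 1))}
  set N2 : Set (ι → Coins n × Seed) := {ω | foundSet A rd H V ω (J + 1) ⊆ H ∧
    ∃ i, (∃ e ∈ H \ foundSet A rd H V ω (J + 1), Touches e (V i)) ∧
      ∀ t : layersOf rd (J + 1), opened A H (foundSet A rd H V ω (J + 1)) (V i) (ω t) = none}
  have hsub : {ω | ¬ IsRecovery H φ V (foundSet A rd H V ω (J + 1)) (complete ω)} ⊆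
      (⋃ j ∈ Finset.range (J + 1), N1 j) ∪ N2 := by
    intro ω hω
    by_contra hnot
    simp only [Set.mem_union, not_or, Set.mem_iUnion, not_exists] at hnot
    obtain ⟨h1, h2⟩ := hnot
    have hinv : ∀ j ≤ J + 1, RoundInvariant H V K J j (foundSet A rd H V ω j) := by
      intro j
      induction j with
      | zero =>
        intro _
        rw [RoundInvariant, if_pos (Nat.zero_le _)]
        refine beforeRound_empty hV K ?_
        simp only [rate, Nat.sub_zero, one_div, inv_pow]
        rw [← div_eq_mul_inv, div_le_one (by positivity)]
        exact_mod_cast hJ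
      | succ j ih =>
        intro hj
        by_contra h
        exact h1 j (Finset.mem_range.2 (by omega)) ⟨ih (by omega), h⟩
    have hlast := hinv (J + 1) le_rfl
    rw [RoundInvariant, if_neg (by omega)] at hlast
    obtain ⟨hS, B, ⟨rep, hrep1, hrep2⟩, hB⟩ := hlast.served_or_complete
    refine hω ⟨hS, fun i hi e he ht => ?_, rep, hrep1, fun i hi => ?_⟩
    · by_contra hes
      exact h2 ⟨hS, i, ⟨e, Finset.mem_sdiff.2 ⟨he, hes⟩, ht⟩, (hc ω i).1 hi⟩
    · refine hKφ.trans ?_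
      -- For an unserved component every incident hyperedge has been found, so its residual vector
      -- is zero and every sampler returns `⊥`. A component labelled incomplete must therefore be
      -- served.
      have hiB : i ∉ B := by
        intro hiB
        have hall : ∀ t : layersOf rd (J + 1),
            opened A H (foundSet A rd H V ω (J + 1)) (V i) (ω t) = none := by
          intro t
          refine opened_eq_none_of_touching_empty A hS _ _ ?_
          rintro ⟨e, he⟩
          obtain ⟨he1, he2⟩ := mem_touching.1 he
          obtain ⟨he3, he4⟩ := Finset.mem_sdiff.1 he1
          refine he4 (hB e he3 i hiB ?_)
          exact ⟨he2.1.mono (Finset.inter_subset_inter_right (Finset.filter_subset _ _)),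
            he2.2.mono (Finset.sdiff_subset_sdiff (Finset.filter_subset _ _) subset_rfl)⟩
        rw [(hc ω i).2 hall] at hi
        cases hi
      refine le_trans (Nat.cast_le.2 (hrep2 i hiB)) (le_of_eq ?_)
      congr!
  have hε0 : 0 ≤ roundError n (K * (140 * s)) s T := by
    have h1 : (0 : ℝ) ≤ 1 - 1 / (8 * (1 + ((K * (140 * s) : ℕ) : ℝ))) := by
      have : (0 : ℝ) ≤ ((K * (140 * s) : ℕ) : ℝ) := Nat.cast_nonneg _
      rw [sub_nonneg, div_le_one (by positivity)]; linarith
    unfold roundError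
    positivity
  have hb1 : μ (⋃ j ∈ Finset.range (J + 1), N1 j) ≤
      ENNReal.ofReal ((J + 1) * roundError n (K * (140 * s)) s T) := by
    refine (measure_biUnion_finset_le _ _).trans ?_
    refine (Finset.sum_le_card_nsmul _ _ (ENNReal.ofReal (roundError n (K * (140 * s)) s T))
      fun j hj => ?_).trans ?_
    · have hj' := Finset.mem_range.1 hj
      have := pi_not_roundInvariant_succ_le A hδ rd hm hV hK hs (Nat.lt_succ_iff.1 hj')
      rwa [hT j (by omega)] at this
    · rw [Finset.card_range, nsmul_eq_mul, ENNReal.ofReal_mul (by positivity)]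
      refine mul_le_mul_left ?_ _
      rw [← Nat.cast_succ, ENNReal.ofReal_natCast]
  have hb2 : μ N2 ≤ ENNReal.ofReal (roundError n (K * (140 * s)) s T) := by
    have := pi_undetected_le A hδ rd hm hV (Nat.le_succ J)
    rw [hT _ (by omega)] at this
    refine this.trans (ENNReal.ofReal_le_ofReal ?_)
    have hr : 1 ≤ K * (140 * s) := Nat.mul_pos hK (by omega)
    -- The labelling round is absorbed into the second term of one more `roundError`, whence the
    -- factor `J + 2`.
    have h2 : (2 : ℝ) ≤ 2 ^ (K * (140 * s)) := by
      simpa using pow_le_pow_right₀ (one_le_two (α := ℝ)) hr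
    have h1 : (0 : ℝ) ≤ 1 - 1 / (8 * (1 + ((K * (140 * s) : ℕ) : ℝ))) := by
      have : (0 : ℝ) ≤ ((K * (140 * s) : ℕ) : ℝ) := Nat.cast_nonneg _
      rw [sub_nonneg, div_le_one (by positivity)]; linarith
    have h3 : (n : ℝ) * (2 * (7 / 8) ^ T) ≤ n * (2 ^ (K * (140 * s)) * (7 / 8) ^ T) := by gcongr
    refine h3.trans ?_
    unfold roundError
    refine le_trans ?_ (le_add_of_nonneg_right (by positivity))
    exact le_add_of_nonneg_left (by positivity)
  refine (measure_mono hsub).trans ((measure_union_le _ _).trans ((add_le_add hb1 hb2).trans ?_))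
  rw [← ENNReal.ofReal_add (by positivity) hε0]
  refine ENNReal.ofReal_le_ofReal (le_of_eq ?_)
  ring

end Rounds

/-! ### The decoder acting on the sketch -/

section Decoding

variable {n m q : ℕ} {δ : ℝ} {Seed : Type*} [MeasurableSpace Seed] {Sk : Type*} [AddCommGroup Sk]
  (A : L0Sampler (Hyperedge n) Seed Sk n m δ) {k : ℕ}

/-- Opening the sketch of the component `W` in layer `t`, after subtracting the hyperedges in `S`. -/
def openSketch (ω : Randomness n q Seed) (y : Fin q → Fin n → Sk) (S : Finset (Hyperedge n))
    (W : Finset (Fin n)) (t : Fin q) : Option (Hyperedge n) :=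
  A.output (ω t).2 (∑ v ∈ W, (y t v - A.sketch (ω t).2 (neighborhoodVector S (ω t).1 v)))

theorem openSketch_fingerprintSketch (ω : Randomness n q Seed) (H S : Finset (Hyperedge n))
    (W : Finset (Fin n)) (t : Fin q) :
    openSketch A ω (fingerprintSketch A H ω) S W t = opened A H S W (ω t) := by
  rw [openSketch, opened, residualVector, map_sum]
  simp only [fingerprintSketch, map_sub]

open Classical in
/-- The hyperedges recovered from the sketch before round `j`. -/
def decodeSet (rd : Fin q → ℕ) (ω : Randomness n q Seed) (y : Fin q → Fin n → Sk)
    (V : Fin k → Finset (Fin n)) : ℕ → Finset (Hyperedge n)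
  | 0 => ∅
  | j + 1 => decodeSet rd ω y V j ∪ Finset.univ.filter fun e =>
      ∃ (t : layersOf rd j) (i : Fin k),
        openSketch A ω y (decodeSet rd ω y V j) (V i) t = some e

theorem decodeSet_fingerprintSketch (rd : Fin q → ℕ) (ω : Randomness n q Seed)
    (H : Finset (Hyperedge n)) (V : Fin k → Finset (Fin n)) (j : ℕ) :
    decodeSet A rd ω (fingerprintSketch A H ω) V j = foundSet A rd H V ω j := by
  induction j with
  | zero => rfl
  | succ j ih =>
    rw [decodeSet, foundSet, ih]
    simp only [openSketch_fingerprintSketch]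
    congr 1
    ext e
    simp [returned]

open Classical in
/-- The recovery procedure: the hyperedges found in rounds `0, …, J` are returned, and round
`J + 1` decides which components are complete. -/
def recover (rd : Fin q → ℕ) (J : ℕ) : Decoder n q Seed Sk := fun ω y _ V =>
  (decodeSet A rd ω y V (J + 1), fun i => decide (∀ t : layersOf rd (J + 1),
    openSketch A ω y (decodeSet A rd ω y V (J + 1)) (V i) t = none))

/-- The round of each of the layers, when every round has `T` layers. -/
def roundOf (N T : ℕ) (t : Fin (N * T)) : ℕ := (finProdFinEquiv.symm t).1

theorem card_layersOf_roundOf (N T j : ℕ) (hj : j < N) :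
    (layersOf (roundOf N T) j).card = T := by
  have : (layersOf (roundOf N T) j).card =
      (({⟨j, hj⟩} : Finset (Fin N)) ×ˢ (Finset.univ : Finset (Fin T))).card := by
    refine Finset.card_equiv finProdFinEquiv.symm fun t => ?_
    rw [layersOf, Finset.mem_filter, Finset.mem_product, Finset.mem_singleton, Fin.ext_iff]
    simp [roundOf]
  rw [this]
  simp

end Decoding

/-! ### Choice of the parameters -/

section Parameters

/-- The parameter bounding how many layers may return the same hyperedge. -/
def repeatBound (l : ℕ) : ℕ := 40000 * l ^ 2

/-- The number of layers per round. -/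
def layerCount (l K : ℕ) : ℕ := 800 * l ^ 2 * (K * (140 * repeatBound l))

theorem one_sub_pow_le_exp {x : ℝ} (hx : x ≤ 1) (T : ℕ) : (1 - x) ^ T ≤ Real.exp (-(T * x)) := by
  have h1 := Real.add_one_le_exp (-x)
  calc (1 - x) ^ T ≤ Real.exp (-x) ^ T := pow_le_pow_left₀ (by linarith) (by linarith) T
    _ = Real.exp (-(T * x)) := by rw [← Real.exp_nat_mul]; ring_nf

/-- With `r = 140 K s` and `T = 800 l² r`, each exponential factor in `roundError` is at most a
constant times `exp(-50 l²)`; the coefficients `2`, `1` and `4` of the three terms add up to `7`. -/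
theorem roundError_le {n l K : ℕ} (hl : 1 ≤ l) (hK : 1 ≤ K) :
    roundError n (K * (140 * repeatBound l)) (repeatBound l) (layerCount l K) ≤
      7 * (n * (layerCount l K * Real.exp (-(50 * (l : ℝ) ^ 2)))) := by
  set s := repeatBound l with hs
  set r := K * (140 * s) with hr
  set T := layerCount l K with hT
  set x := Real.exp (-(50 * (l : ℝ) ^ 2)) with hx
  have hl2 : 1 ≤ l ^ 2 := Nat.one_le_pow _ _ hl
  have hl2' : (1 : ℝ) ≤ (l : ℝ) ^ 2 := by exact_mod_cast hl2
  have hs1 : 1 ≤ s := by rw [hs, repeatBound]; omega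
  have hr1 : 1 ≤ r := Nat.mul_pos hK (by omega)
  have hr1' : (1 : ℝ) ≤ r := by exact_mod_cast hr1
  have hTr : (T : ℝ) = 800 * (l : ℝ) ^ 2 * r := by
    rw [hT, layerCount, ← hs, ← hr]; push_cast; ring
  have hsr : (s : ℝ) = 40000 * (l : ℝ) ^ 2 := by rw [hs, repeatBound]; push_cast; ring
  have hrT : (r : ℝ) ≤ T := by rw [hTr]; nlinarith
  have h2e : (2 : ℝ) ≤ Real.exp 1 := by linarith [Real.add_one_le_exp (1 : ℝ)]
  -- The moment factor costs `exp(24 T / r) = exp(19200 l²)`. The choice `s = 40000 l²` beats it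
  -- even with `2^(-s)` weakened to `exp(-s/2) = exp(-20000 l²)`.
  have t1 : (1 / 2 : ℝ) ^ s * (2 * (1 + 24 / (r : ℝ)) ^ T) ≤ 2 * x := by
    have e1 : (1 / 2 : ℝ) ^ s ≤ Real.exp (-(s * (1 / 2))) := by
      have := one_sub_pow_le_exp (x := 1 / 2) (by norm_num) s
      norm_num at this ⊢
      exact this
    have e2 : (1 + 24 / (r : ℝ)) ^ T ≤ Real.exp (24 * 800 * (l : ℝ) ^ 2) := by
      calc (1 + 24 / (r : ℝ)) ^ T ≤ Real.exp (24 / (r : ℝ)) ^ T := by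
            refine pow_le_pow_left₀ (by positivity) ?_ T
            linarith [Real.add_one_le_exp (24 / (r : ℝ))]
        _ = Real.exp (24 * 800 * (l : ℝ) ^ 2) := by
            rw [← Real.exp_nat_mul, hTr]
            congr 1
            field_simp
    calc _ ≤ Real.exp (-(s * (1 / 2))) * (2 * Real.exp (24 * 800 * (l : ℝ) ^ 2)) := by gcongr
      _ = 2 * Real.exp (-(800 * (l : ℝ) ^ 2)) := by
          rw [mul_left_comm, ← Real.exp_add, hsr]; ring_nf
      _ ≤ 2 * x := by
          refine mul_le_mul_of_nonneg_left (Real.exp_le_exp.2 ?_) (by norm_num)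
          nlinarith
  have t2 : (2 : ℝ) ^ r * (7 / 8) ^ T ≤ x := by
    have e1 : (2 : ℝ) ^ r ≤ Real.exp r := by
      rw [← mul_one (r : ℝ), Real.exp_nat_mul]
      exact pow_le_pow_left₀ (by norm_num) h2e r
    have e2 : (7 / 8 : ℝ) ^ T ≤ Real.exp (-(T * (1 / 8))) := by
      have := one_sub_pow_le_exp (x := 1 / 8) (by norm_num) T
      norm_num at this ⊢
      exact this
    calc _ ≤ Real.exp r * Real.exp (-(T * (1 / 8))) := by gcongr
      _ ≤ x := by
          rw [← Real.exp_add, hTr]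
          refine Real.exp_le_exp.2 ?_
          nlinarith
  -- The exponent is `100 l² · r / (1 + r)`, which is at least `50 l²` because `r ≥ 1`.
  have t3 : (1 - 1 / (8 * (1 + (r : ℝ)))) ^ T ≤ x := by
    refine (one_sub_pow_le_exp ?_ T).trans (Real.exp_le_exp.2 ?_)
    · rw [div_le_one (by positivity)]; linarith
    · rw [neg_le_neg_iff, mul_one_div, le_div_iff₀ (by positivity), hTr]
      nlinarith
  have hT1 : (1 : ℝ) ≤ T := hr1'.trans hrT
  have hfrac : (0 : ℝ) ≤ 1 - 1 / (8 * (1 + (r : ℝ))) := by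
    rw [sub_nonneg, div_le_one (by positivity)]; linarith
  have hn : (0 : ℝ) ≤ n := Nat.cast_nonneg n
  have hx0 : 0 < x := Real.exp_pos _
  unfold roundError
  have f1 : (n : ℝ) * (T * ((1 / 2 : ℝ) ^ s * (2 * (1 + 24 / (r : ℝ)) ^ T))) ≤
      n * (T * (2 * x)) := by gcongr
  have f2 : (n : ℝ) * (2 ^ r * (7 / 8) ^ T) ≤ n * (T * x) := by
    refine mul_le_mul_of_nonneg_left (t2.trans ?_) hn
    nlinarith
  have f3 : 2 * ((n : ℝ) * r) * (2 * (1 - 1 / (8 * (1 + (r : ℝ)))) ^ T) ≤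
      2 * (n * T) * (2 * x) :=
    mul_le_mul (by gcongr) (by linarith) (mul_nonneg (by norm_num) (pow_nonneg hfrac _))
      (by positivity)
  nlinarith

theorem mul_roundError_le {n l K J : ℕ} (hl : 1 ≤ l) (hK : 1 ≤ K) (hn : n ≤ 2 ^ l)
    (hK2 : K ≤ 2 ^ (l + 1)) (hJ : J ≤ l) :
    (J + 2) * roundError n (K * (140 * repeatBound l)) (repeatBound l) (layerCount l K) ≤
      1 / 2 ^ (l ^ 2) := by
  set x := Real.exp (-(50 * (l : ℝ) ^ 2)) with hx
  have hx0 : 0 < x := Real.exp_pos _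
  have hxle : x ≤ 1 / 2 ^ (50 * l ^ 2) := by
    have h2e : (2 : ℝ) ≤ Real.exp 1 := by linarith [Real.add_one_le_exp (1 : ℝ)]
    have : (2 : ℝ) ^ (50 * l ^ 2) ≤ Real.exp (50 * (l : ℝ) ^ 2) := by
      have h3 : Real.exp (50 * (l : ℝ) ^ 2) = Real.exp 1 ^ (50 * l ^ 2) := by
        rw [← Real.exp_nat_mul]; push_cast; ring_nf
      rw [h3]
      exact pow_le_pow_left₀ (by norm_num) h2e _
    rw [hx, Real.exp_neg, ← one_div]
    exact one_div_le_one_div_of_le (by positivity) this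
  -- All polynomial factors are at most `2^(38 + 7 l)`, which fits under `2^(49 l²)` as `l ≥ 1`; a
  -- factor `2^(-l²)` of the error bound is left over.
  have hnat : (J + 2) * (7 * (n * layerCount l K)) ≤ 2 ^ (49 * l ^ 2) := by
    have hll : l ≤ 2 ^ l := Nat.lt_two_pow_self.le
    have h1 : J + 2 ≤ 3 * 2 ^ l := by
      have : 1 ≤ 2 ^ l := Nat.one_le_two_pow
      omega
    have h2 : layerCount l K ≤ 4480000000 * (2 ^ l) ^ 4 * 2 ^ (l + 1) := by
      have : layerCount l K = 4480000000 * l ^ 4 * K := by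
        rw [layerCount, repeatBound]; ring
      rw [this]
      gcongr
    calc (J + 2) * (7 * (n * layerCount l K))
        ≤ (3 * 2 ^ l) * (7 * (2 ^ l * (4480000000 * (2 ^ l) ^ 4 * 2 ^ (l + 1)))) := by gcongr
      _ = 188160000000 * 2 ^ (7 * l) := by ring
      _ ≤ 2 ^ 38 * 2 ^ (7 * l) := Nat.mul_le_mul_right _ (by norm_num)
      _ = 2 ^ (38 + 7 * l) := by rw [pow_add]
      _ ≤ 2 ^ (49 * l ^ 2) := Nat.pow_le_pow_right (by norm_num) (by nlinarith)
  have hreal : ((J : ℝ) + 2) * (7 * (n * layerCount l K)) ≤ 2 ^ (49 * l ^ 2) := by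
    exact_mod_cast hnat
  calc ((J : ℝ) + 2) * roundError n (K * (140 * repeatBound l)) (repeatBound l) (layerCount l K)
      ≤ (J + 2) * (7 * (n * (layerCount l K * x))) :=
        mul_le_mul_of_nonneg_left (roundError_le hl hK) (by positivity)
    _ = ((J + 2) * (7 * (n * layerCount l K))) * x := by ring
    _ ≤ 2 ^ (49 * l ^ 2) * (1 / 2 ^ (50 * l ^ 2)) := by gcongr
    _ = 1 / 2 ^ (l ^ 2) := by
        have : (2 : ℝ) ^ (50 * l ^ 2) = 2 ^ (49 * l ^ 2) * 2 ^ (l ^ 2) := by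
          rw [← pow_add]; congr 1; ring
        rw [this]
        field_simp

end Parameters

instance {n q : ℕ} (p : Fin q → unitInterval) {Seed : Type*} [MeasurableSpace Seed]
    (μ : Measure Seed) [IsProbabilityMeasure μ] : IsProbabilityMeasure (randomnessLaw (n := n) p μ) := by
  unfold randomnessLaw; infer_instance

end HypergraphSketch

end

/-! ### The recovery theorem -/

open HypergraphSketch in
theorem mainTheorem3 :
    ∃ (C c : ℝ) (a : ℕ), 0 < c ∧
      ∀ (n : ℕ) (φ : ℝ), 0 < n → 1 ≤ φ →
        ∃ (q : ℕ) (p : Fin q → unitInterval),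
          (q : ℝ) ≤ C * φ * Real.logb 2 (n * φ) ^ a ∧
          ∀ (m : ℕ) (δ : ℝ), δ ≤ 1 / 2 →
            ∀ (Seed : Type*) [MeasurableSpace Seed] (Sk : Type*) [AddCommGroup Sk]
              (A : L0Sampler (Hyperedge n) Seed Sk n m δ),
              ∃ decode : Decoder n q Seed Sk,
                ∀ H : Finset (Hyperedge n), H.card ≤ m →
                  ∀ (k : ℕ) (V : Fin k → Finset (Fin n)), Pairwise (Function.onFun Disjoint V) →
                    randomnessLaw p A.law
                        {ω | ¬ IsRecovery H φ V
                          (decode ω (fingerprintSketch A H ω) k V).1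
                          (decode ω (fingerprintSketch A H ω) k V).2} ≤
                      ENNReal.ofReal (2 ^ (-c * Real.logb 2 n ^ 2)) := by
  refine ⟨10 ^ 12, 1, 6, one_pos, fun n φ hn hφ => ?_⟩
  -- For `n = 1` the allowed failure probability is `1`, while `log (n φ)` may vanish and force `q =
  -- 0`; so no layers are used. For `n ≥ 2` both logarithms are at least `1`.
  rcases Nat.lt_or_ge n 2 with hn2 | hn2
  · obtain rfl : n = 1 := by omega
    refine ⟨0, Fin.elim0, ?_, fun m δ _ Seed _ Sk _ A => ⟨fun _ _ _ _ => (∅, fun _ => true),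
      fun H _ k V _ => ?_⟩⟩
    · have : 0 ≤ Real.logb 2 (((1 : ℕ) : ℝ) * φ) :=
        Real.logb_nonneg one_lt_two (by simpa using hφ)
      rw [Nat.cast_zero]
      positivity
    · refine prob_le_one.trans ?_
      simp
  have hφ0 : 0 < φ := by linarith
  have hn1 : (2 : ℝ) ≤ n := by exact_mod_cast hn2
  have hnφ : (2 : ℝ) ≤ n * φ := by nlinarith
  set L := Real.logb 2 (n * φ) with hL
  have hL1 : 1 ≤ L := by
    rw [hL, Real.le_logb_iff_rpow_le one_lt_two (by linarith), Real.rpow_one]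
    exact hnφ
  have hlogn1 : 1 ≤ Real.logb 2 n := by
    rw [Real.le_logb_iff_rpow_le one_lt_two (by linarith), Real.rpow_one]
    exact hn1
  have hlognL : Real.logb 2 n ≤ L :=
    Real.logb_le_logb_of_le one_lt_two (by linarith) (by nlinarith)
  set l := ⌈L⌉₊ with hl
  have hLl : L ≤ l := Nat.le_ceil L
  have hl1 : 1 ≤ l := Nat.ceil_pos.2 (by linarith)
  have hl2 : (l : ℝ) ≤ 2 * L := by
    have := Nat.ceil_lt_add_one (a := L) (by linarith)
    linarith
  have hnφl : (n : ℝ) * φ ≤ 2 ^ l := by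
    rw [← Real.rpow_natCast, ← Real.logb_le_iff_le_rpow one_lt_two (by linarith)]
    exact hLl
  have hnl : n ≤ 2 ^ l := by
    have : (n : ℝ) ≤ ((2 ^ l : ℕ) : ℝ) := by push_cast; nlinarith
    exact_mod_cast this
  set K := ⌈φ * Real.logb 2 n⌉₊ with hKdef
  have hKφ : φ * Real.logb 2 n ≤ K := Nat.le_ceil _
  have hK1 : 1 ≤ K := Nat.ceil_pos.2 (by positivity)
  have hKlt : (K : ℝ) < φ * Real.logb 2 n + 1 := Nat.ceil_lt_add_one (by positivity)
  have hKL : (K : ℝ) ≤ 2 * φ * L := by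
    have : φ * Real.logb 2 n ≤ φ * L := mul_le_mul_of_nonneg_left hlognL hφ0.le
    nlinarith
  have hK2 : K ≤ 2 ^ (l + 1) := by
    have h1 : Real.logb 2 n ≤ n := by
      rw [Real.logb_le_iff_le_rpow one_lt_two (by linarith), Real.rpow_natCast]
      exact_mod_cast Nat.lt_two_pow_self.le
    have h2 : φ * Real.logb 2 n ≤ n * φ := by nlinarith
    have h3 : (1 : ℝ) ≤ 2 ^ l := one_le_pow₀ one_le_two
    have h4 : (K : ℝ) ≤ ((2 ^ (l + 1) : ℕ) : ℝ) := by
      push_cast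
      rw [pow_succ]
      linarith
    exact_mod_cast h4
  -- The least `J` for which the initial rate `2^(-J)` is at most `1/n`.
  set J := Nat.clog 2 n with hJdef
  have hJn : n ≤ 2 ^ J := Nat.le_pow_clog one_lt_two n
  have hJl : J ≤ l := Nat.clog_le_of_le_pow hnl
  refine ⟨(J + 2) * layerCount l K, fun t => rate J (roundOf (J + 2) (layerCount l K) t), ?_,
    fun m δ hδ Seed _ Sk _ A => ⟨recover A (roundOf (J + 2) (layerCount l K)) J,
      fun H hm k V hV => ?_⟩⟩
  · have h1 : (((J + 2) * layerCount l K : ℕ) : ℝ) = (J + 2) * (4480000000 * l ^ 4 * K) := by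
      rw [layerCount, repeatBound]; push_cast; ring
    rw [h1]
    have h2 : (J : ℝ) + 2 ≤ 6 * L := by
      have h3 : (J : ℝ) ≤ l := by exact_mod_cast hJl
      linarith
    calc ((J : ℝ) + 2) * (4480000000 * l ^ 4 * K)
        ≤ (6 * L) * (4480000000 * (2 * L) ^ 4 * (2 * φ * L)) := by gcongr
      _ = 860160000000 * φ * L ^ 6 := by ring
      _ ≤ 10 ^ 12 * φ * L ^ 6 := by gcongr; norm_num
  · have h := pi_not_isRecovery_le A hδ (roundOf (J + 2) (layerCount l K)) hm hV hK1
      (s := repeatBound l) (Nat.mul_pos (by norm_num) (by positivity)) hKφ hJn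
      (fun j hj => card_layersOf_roundOf (J + 2) (layerCount l K) j hj)
      (fun ω => (recover A (roundOf (J + 2) (layerCount l K)) J ω
        (fingerprintSketch A H ω) k V).2) (fun ω i => by
          simp only [recover, decide_eq_true_eq, openSketch_fingerprintSketch,
            decodeSet_fingerprintSketch])
    have hrec : ∀ ω, (recover A (roundOf (J + 2) (layerCount l K)) J ω
        (fingerprintSketch A H ω) k V).1 =
          foundSet A (roundOf (J + 2) (layerCount l K)) H V ω (J + 1) := fun ω => by
      simp only [recover, decodeSet_fingerprintSketch]
    simp_rw [hrec]
    refine h.trans (ENNReal.ofReal_le_ofReal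
      ((mul_roundError_le hl1 hK1 hnl hK2 hJl).trans ?_))
    have h5 : (1 : ℝ) / 2 ^ (l ^ 2) = 2 ^ (-((l : ℝ) ^ 2)) := by
      rw [Real.rpow_neg (by norm_num), one_div]
      congr 1
      exact_mod_cast (Real.rpow_natCast 2 (l ^ 2)).symm
    rw [h5]
    refine Real.rpow_le_rpow_of_exponent_le one_le_two ?_
    have h6 : Real.logb 2 n ≤ l := hlognL.trans hLl
    nlinarith
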